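/- **Theorem 4.1 (the Gram–Schmidt process for Szegő kernels is realizable).** Let $m\ge 1$, let $\mathscr A_m$ be the real Clifford algebra generated by $e_1,\dots,e_m$ with $e_ie_j+e_je_i=-2\delta_{ij}$, with basis $e_T=e_{i_1}\cdots e_{i_l}$ ($T=\{i_1<\dots<i_l\}$), conjugation $x\mapsto\overline x$ (the antiautomorphism with $\overline{e_i}=-e_i$), norm $|x|=(\sum_T x_T^2)^{1/2}$ and scalar part $\mathrm{Sc}\,x=x_\emptyset$. Put $e_0=1$ and identify $x\in\mathbb R^{m+1}$ with $\sum_{i=0}^m x_ie_i\in\mathscr A_m$. Let $B^{m+1}$ be the open unit ball of $\mathbb R^{m+1}$, $S^m$ its boundary sphere with surface element $dS$, and $\omega_m=2\pi^{\frac{m+1}{2}}/\Gamma(\frac{m+1}{2})$ its area. The monogenic Hardy space $\mathcal H^2(B^{m+1})$ consists of the $C^1$ functions $f:B^{m+1}\to\mathscr A_m$ with $\sum_{i=0}^m e_i\,\partial f/\partial x_i=0$ and $$\|f\|=\sup_{0<r<1}\Big(\frac1{\omega_m}\int_{S^m}|f(r\eta)|^2\,dS\Big)^{1/2}<\infty ,$$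 and, with non-tangential boundary values on $S^m$, $$\langle f,g\rangle=\frac1{\omega_m}\int_{S^m}\overline{g(\eta)}\,f(\eta)\,dS\in\mathscr A_m .$$ For $a\in B^{m+1}$ let $$S_a(x)=\frac{\overline{1-\overline a x}}{|1-\overline a x|^{m+1}},\qquad x\in B^{m+1},$$ be the Szegő kernel. Let $a_1,a_2,\dots$ be pairwise distinct points of $B^{m+1}$. Then the Gram–Schmidt recursion $$T_{a_1}=S_{a_1},\qquad T_{a_1,\dots,a_n}=S_{a_n}-\sum_{i=1}^{n-1}T_{a_1,\dots,a_i}\,\langle T_{a_1,\dots,a_i},T_{a_1,\dots,a_i}\rangle^{-1}\,\langle S_{a_n},T_{a_1,\dots,a_i}\rangle\quad(n\ge2)$$ is well defined: all $S_{a_n}$ and all $T_{a_1,\dots,a_n}$ belong to $\mathcal H^2(B^{m+1})$ and have non-tangential boundary values almost everywhere on $S^m$ that are square integrable, and $\langle T_{a_1,\dots,a_n},T_{a_1,\dots,a_n}\rangle$ is invertible in $\mathscr A_m$ for every $n\ge1$. The functions $T_{a_1,\dots,a_n}$ are pairwise orthogonal with $\|T_{a_1,\dots,a_n}\|>0$,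 and the Clifford Takenaka–Malmquist functions $B_n=T_{a_1,\dots,a_n}/\|T_{a_1,\dots,a_n}\|$ form an orthonormal system: they belong to $\mathcal H^2(B^{m+1})$ and have square integrable non-tangential boundary values almost everywhere, $\langle B_i,B_j\rangle=0$ for $i\ne j$, and $\|B_n\|^2=\mathrm{Sc}\,\langle B_n,B_n\rangle=1$ for every $n$. -/

import Mathlib

open MeasureTheory Filter Topology

namespace CliffTM

/-! ### The real Clifford algebra with `m` anticommuting generators of square `-1` -/

/-- The quadratic form `v ↦ -(v₁² + ⋯ + vₘ²)` on `ℝᵐ`. -/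
noncomputable def negForm (m : ℕ) : QuadraticForm ℝ (Fin m → ℝ) :=
  QuadraticMap.weightedSumSquares ℝ (fun _ : Fin m => (-1 : ℝ))

/-- The real Clifford algebra generated by `e₁, …, eₘ` with `eᵢ eⱼ + eⱼ eᵢ = -2 δᵢⱼ`. Its `star`
is Clifford conjugation: the antiautomorphism with `star eᵢ = -eᵢ`. -/
abbrev Cl (m : ℕ) : Type := CliffordAlgebra (negForm m)

/-- The generator `eᵢ`; the index set `Fin m` stands for `{1, …, m}`. -/
noncomputable def gen {m : ℕ} (i : Fin m) : Cl m :=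
  CliffordAlgebra.ι (negForm m) (Pi.single i 1)

/-- The basic element `e_T = e_{i₁} ⋯ e_{iₗ}`, where `T = {i₁ < ⋯ < iₗ}`. -/
noncomputable def blade {m : ℕ} (T : Finset (Fin m)) : Cl m :=
  ((T.sort (· ≤ ·)).map gen).prod

theorem gen_mul_self {m : ℕ} (i : Fin m) : gen i * gen i = -1 := by
  have h : negForm m (Pi.single i 1) = -1 := by
    simp [negForm, QuadraticMap.weightedSumSquares_apply, Pi.single_apply]
  rw [gen, CliffordAlgebra.ι_sq_scalar, h, map_neg, map_one]

theorem gen_mul_gen {m : ℕ} {i j : Fin m} (h : i ≠ j) : gen i * gen j = -(gen j * gen i) := by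
  apply CliffordAlgebra.ι_mul_ι_comm_of_isOrtho
  rw [QuadraticMap.isOrtho_def]
  simp only [negForm, QuadraticMap.weightedSumSquares_apply, Pi.add_apply, Pi.single_apply]
  rw [← Finset.sum_add_distrib]
  refine Finset.sum_congr rfl fun k _ => ?_
  by_cases h1 : k = i <;> by_cases h2 : k = j <;> simp_all

theorem gen_mul_list {m : ℕ} (i : Fin m) : ∀ l : List (Fin m), l.Pairwise (· < ·) →
    gen i * (l.map gen).prod ∈ Submodule.span ℝ
      {x : Cl m | ∃ l' : List (Fin m), l'.Pairwise (· < ·) ∧ l' ⊆ i :: l ∧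
        x = (l'.map gen).prod}
  | [], _ => Submodule.subset_span ⟨[i], by simp, by simp, by simp⟩
  | h :: t, hl => by
    rw [List.pairwise_cons] at hl
    rcases lt_trichotomy i h with hi | hi | hi
    · refine Submodule.subset_span ⟨i :: h :: t, ?_, by simp, by simp⟩
      refine List.pairwise_cons.2 ⟨?_, List.pairwise_cons.2 hl⟩
      intro b hb
      rcases List.mem_cons.1 hb with rfl | hb
      · exact hi
      · exact hi.trans (hl.1 b hb)
    · subst hi
      have : gen i * (List.map gen (i :: t)).prod = -(t.map gen).prod := by
        rw [List.map_cons, List.prod_cons, ← mul_assoc, gen_mul_self, neg_one_mul]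
      rw [this]
      exact Submodule.neg_mem _ (Submodule.subset_span
        ⟨t, hl.2, fun x hx => by simp [hx], rfl⟩)
    · have : gen i * (List.map gen (h :: t)).prod
          = -(gen h * (gen i * (t.map gen).prod)) := by
        rw [List.map_cons, List.prod_cons, ← mul_assoc, gen_mul_gen hi.ne', neg_mul, mul_assoc]
      rw [this]
      refine Submodule.neg_mem _ ?_
      have key := Submodule.mem_map_of_mem (f := LinearMap.mulLeft ℝ (gen h))
        (gen_mul_list i t hl.2)
      rw [Submodule.map_span] at key
      refine Submodule.span_mono ?_ key
      rintro _ ⟨_, ⟨l', h1, h2, rfl⟩, rfl⟩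
      refine ⟨h :: l', List.pairwise_cons.2 ⟨?_, h1⟩, ?_, by simp⟩
      · intro b hb
        rcases List.mem_cons.1 (h2 hb) with rfl | hb
        · exact hi
        · exact hl.1 b hb
      · intro b hb
        rcases List.mem_cons.1 hb with rfl | hb
        · simp
        · rcases List.mem_cons.1 (h2 hb) with rfl | hb
          · simp
          · simp [hb]

theorem gen_mul_blade_mem {m : ℕ} (i : Fin m) (T : Finset (Fin m)) :
    gen i * blade T ∈ Submodule.span ℝ (Set.range (blade (m := m))) := by
  refine Submodule.span_mono ?_ (gen_mul_list i _ (Finset.sortedLT_sort T).pairwise)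
  rintro _ ⟨l', h1, -, rfl⟩
  refine ⟨l'.toFinset, ?_⟩
  rw [blade]
  congr 2
  exact (List.toFinset_sort (· ≤ ·) (h1.imp ne_of_lt)).2 (h1.imp le_of_lt)

theorem span_blade (m : ℕ) : (⊤ : Submodule ℝ (Cl m)) ≤ Submodule.span ℝ (Set.range blade) := by
  intro x _
  induction x using CliffordAlgebra.left_induction with
  | algebraMap r =>
    rw [Algebra.algebraMap_eq_smul_one]
    exact Submodule.smul_mem _ _ (Submodule.subset_span ⟨∅, by simp [blade]⟩)
  | add x y hx hy => exact Submodule.add_mem _ (hx trivial) (hy trivial)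
  | ι_mul x v hx =>
    have hv : CliffordAlgebra.ι (negForm m) v = ∑ i, v i • gen i := by
      conv_lhs => rw [pi_eq_sum_univ' v]
      simp only [map_sum, map_smul, gen]
    rw [hv, Finset.sum_mul]
    refine Submodule.sum_mem _ fun i _ => ?_
    rw [smul_mul_assoc]
    refine Submodule.smul_mem _ _ ?_
    have key := Submodule.mem_map_of_mem (f := LinearMap.mulLeft ℝ (gen i)) (hx trivial)
    rw [Submodule.map_span] at key
    refine Submodule.span_le.2 ?_ key
    rintro _ ⟨_, ⟨T, rfl⟩, rfl⟩
    exact gen_mul_blade_mem i T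

theorem finrank_Cl (m : ℕ) : Fintype.card (Finset (Fin m)) = Module.finrank ℝ (Cl m) := by
  rw [(CliffordAlgebra.equivExterior (negForm m)).finrank_eq,
    Module.finrank_eq_card_basis (Pi.basisFun ℝ (Fin m)).ExteriorAlgebra]

/-- The elements `e_T` form a basis of the Clifford algebra. -/
noncomputable def bladeBasis (m : ℕ) : Module.Basis (Finset (Fin m)) ℝ (Cl m) :=
  basisOfTopLeSpanOfCardEqFinrank blade (span_blade m) (finrank_Cl m)

theorem bladeBasis_apply {m : ℕ} (T : Finset (Fin m)) : bladeBasis m T = blade T := by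
  simp [bladeBasis]

/-- The scalar part `Sc x = x_∅` of `x = ∑ x_T e_T`. -/
noncomputable def Sc {m : ℕ} (x : Cl m) : ℝ := (bladeBasis m).repr x ∅

/-- The coordinates `(x_T)` of a Clifford number, as a vector of a Euclidean space. -/
noncomputable def coords (m : ℕ) : Cl m ≃ₗ[ℝ] EuclideanSpace ℝ (Finset (Fin m)) :=
  (bladeBasis m).equivFun.trans (WithLp.linearEquiv 2 ℝ (Finset (Fin m) → ℝ)).symm

/-- The norm `|x| = (∑ x_T²)^{1/2}` on the Clifford algebra. -/
noncomputable instance instNormedAddCommGroupCl (m : ℕ) : NormedAddCommGroup (Cl m) :=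
  NormedAddCommGroup.induced (Cl m) (EuclideanSpace ℝ (Finset (Fin m))) (coords m)
    (coords m).injective

noncomputable instance instNormedSpaceCl (m : ℕ) : NormedSpace ℝ (Cl m) :=
  NormedSpace.induced ℝ (Cl m) (EuclideanSpace ℝ (Finset (Fin m))) (coords m)

theorem norm_def {m : ℕ} (x : Cl m) : ‖x‖ = √(∑ T, (bladeBasis m).repr x T ^ 2) := by
  change ‖coords m x‖ = _
  simp [EuclideanSpace.norm_eq, coords]

/-! ### Paravectors and monogenic functions -/

/-- The space `ℝ^{m+1}` with coordinates `x₀, x₁, …, xₘ` and the Euclidean norm. -/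
abbrev E (m : ℕ) : Type := EuclideanSpace ℝ (Fin (m + 1))

/-- `e₀ = 1` and the generators `e₁, …, eₘ`. -/
noncomputable def e {m : ℕ} (i : Fin (m + 1)) : Cl m :=
  Fin.cases 1 (fun j => gen j) i

/-- The embedding `x ↦ x₀ e₀ + x₁ e₁ + ⋯ + xₘ eₘ` of `ℝ^{m+1}` into the Clifford algebra. -/
noncomputable def para {m : ℕ} (x : E m) : Cl m := ∑ i, x i • e i

/-- The generalized Cauchy–Riemann operator `Df = ∑ᵢ eᵢ ∂f/∂xᵢ`. -/
noncomputable def dirac {m : ℕ} (f : E m → Cl m) (x : E m) : Cl m :=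
  ∑ i, e i * fderiv ℝ f x (EuclideanSpace.single i 1)

/-- Left monogenic (continuously differentiable) functions on an open set `Ω`. -/
def IsLeftMonogenicOn {m : ℕ} (f : E m → Cl m) (Ω : Set (E m)) : Prop :=
  ContDiffOn ℝ 1 f Ω ∧ ∀ x ∈ Ω, dirac f x = 0

/-! ### The monogenic Hardy space of the unit ball

A function on the unit ball is represented by a function on `ℝ^{m+1}`; all notions below depend
only on its values in the open unit ball. -/

/-- The surface area `ω_m = 2 π^{(m+1)/2} / Γ((m+1)/2)` of the unit sphere of `ℝ^{m+1}`. -/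
noncomputable def area (m : ℕ) : ℝ :=
  2 * Real.pi ^ (((m : ℝ) + 1) / 2) / Real.Gamma (((m : ℝ) + 1) / 2)

/-- The unit sphere `S^m` of `ℝ^{m+1}`. -/
abbrev Sph (m : ℕ) : Type := Metric.sphere (0 : E m) 1

/-- The surface area element `dS` on the unit sphere. -/
noncomputable abbrev surf (m : ℕ) : Measure (Sph m) := (volume : Measure (E m)).toSphere

/-- The Hardy norm `sup_{0<r<1} ((1/ω_m) ∫_{S^m} |f(rη)|² dS)^{1/2}`, possibly infinite. -/
noncomputable def hardyENorm {m : ℕ} (f : E m → Cl m) : ENNReal :=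
  ⨆ r ∈ Set.Ioo (0 : ℝ) 1,
    (ENNReal.ofReal (area m)⁻¹ *
      ∫⁻ η : Sph m, ‖f (r • (η : E m))‖ₑ ^ 2 ∂(surf m)) ^ ((1 : ℝ) / 2)

/-- Membership in the monogenic Hardy space of the unit ball. -/
def MemHardy {m : ℕ} (f : E m → Cl m) : Prop :=
  IsLeftMonogenicOn f (Metric.ball 0 1) ∧ hardyENorm f < ⊤

/-- The Hardy norm as a real number (meant for members of the Hardy space). -/
noncomputable def hardyNorm {m : ℕ} (f : E m → Cl m) : ℝ := (hardyENorm f).toReal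

/-- The non-tangential approach region `{x : |x| < 1, |x - η| < α (1 - |x|)}`. -/
def approach {m : ℕ} (α : ℝ) (η : Sph m) : Set (E m) :=
  {x | ‖x‖ < 1 ∧ ‖x - η‖ < α * (1 - ‖x‖)}

/-- `f` has the non-tangential limit `L` at the boundary point `η`. -/
def HasNTLimit {m : ℕ} (f : E m → Cl m) (η : Sph m) (L : Cl m) : Prop :=
  ∀ α : ℝ, 1 < α → Tendsto f (𝓝[approach α η] (η : E m)) (𝓝 L)

open Classical in
/-- The non-tangential boundary function of `f` (with value `0` where there is no limit). -/
noncomputable def bdry {m : ℕ} (f : E m → Cl m) (η : Sph m) : Cl m :=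
  if h : ∃ L, HasNTLimit f η L then h.choose else 0

/-- `f` has non-tangential limits at almost every point of the sphere, and they form a
square integrable function, so that no junk value enters the inner products of such functions. -/
def HasL2Boundary {m : ℕ} (f : E m → Cl m) : Prop :=
  (∀ᵐ η ∂(surf m), HasNTLimit f η (bdry f η)) ∧ MemLp (bdry f) 2 (surf m)

/-- The Clifford-valued inner product `⟨f, g⟩ = (1/ω_m) ∫_{S^m} \overline{g(η)} f(η) dS`. -/
noncomputable def hardyInner {m : ℕ} (f g : E m → Cl m) : Cl m :=
  (area m)⁻¹ • ∫ η : Sph m, star (bdry g η) * bdry f η ∂(surf m)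

/-! ### Szegő kernels and the Gram–Schmidt process -/

/-- The Szegő kernel `S_a(x) = \overline{1 - \bar a x} / |1 - \bar a x|^{m+1}`. -/
noncomputable def szego {m : ℕ} (a x : E m) : Cl m :=
  (‖1 - star (para a) * para x‖ ^ (m + 1))⁻¹ • star (1 - star (para a) * para x)

/-- The Gram–Schmidt recursion
`T_n = S_{a_n} - ∑_{i<n} T_i ⟨T_i, T_i⟩⁻¹ ⟨S_{a_n}, T_i⟩`; the sequence starts at `a 0`.
`Ring.inverse` is the two-sided inverse of an invertible element (and `0` otherwise). -/
noncomputable def gsT {m : ℕ} (a : ℕ → E m) (n : ℕ) : E m → Cl m := fun x =>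
  szego (a n) x - ∑ i : Fin n, gsT a i x *
    (Ring.inverse (hardyInner (gsT a i) (gsT a i)) * hardyInner (szego (a n)) (gsT a i))
termination_by n
decreasing_by all_goals exact i.2

/-- The Takenaka–Malmquist system `B_n = T_n / ‖T_n‖`. -/
noncomputable def tmB {m : ℕ} (a : ℕ → E m) (n : ℕ) : E m → Cl m := fun x =>
  (hardyNorm (gsT a n))⁻¹ • gsT a n x

end CliffTM

/-!
# The Gram–Schmidt process for Szegő kernels

All functions of the process are right linear combinations of Szegő kernels with parameters in the
open ball. Such a combination `f` is monogenic across the unit sphere, so its non-tangential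
boundary values are its ordinary values, and the inner products are integrals of continuous
functions over the sphere.

*Positivity.* With `|x|² = Sc (\bar x x)`, left multiplication by `c` is adjoint to left
multiplication by `\bar c` (`ip_mul`). Hence `Sc (\bar v ⟨f, f⟩ v)` is the mean of `|f v|²` over the
sphere, and in the finite-dimensional algebra `⟨f, f⟩` is invertible as soon as `f v` vanishes on
the sphere only for `v = 0` (`isUnit_of_mul_injective`). For `f = T_n` this follows from the right
linear independence of the Szegő kernels (`szego_linearIndependent`), because `S_{a_n}` enters
`T_n` with coefficient `1`.

*Spherical means.* Both the value of the Hardy norm and the linear independence rest on the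
inequality `M(r) ≤ M(1)` for `M(r) = ∫ |f(rη)|² dS` (`IsMonogenicNearBall.sqInt_le_one`). On
monogenic functions the Euler operator is the angular operator
`-½ ∑ \bar e_i e_j (x_i ∂_j - x_j ∂_i)`. Since the rotations preserve `dS`, the fields
`x_i ∂_j - x_j ∂_i` are skew on the sphere, and as `\bar e_i e_j` is skew as well, the Euler operator
is symmetric (`integral_euler_sub_eq_zero`). Integrating in the dilation parameter gives
`⟨f(r·), f(r·)⟩ = ⟨f, f(r²·)⟩` (`integral_dilate_mul_dilate`), so that `2 M(r) ≤ M(r²) + M(1)`; as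
`M` is bounded, iteration yields `M(r) ≤ M(1)`. In particular the Hardy norm is the `L²` norm of the
boundary values, and a combination of kernels that vanishes on the sphere vanishes in the ball.

*Linear independence.* Such a combination then vanishes off the poles by analytic continuation. The
pole of `S_a` is `a / |a|²`, and `|S_a(x) d|² = |1 - \bar a x|^{-2m} |d|²` is unbounded there unless
`d = 0`, whereas the kernels with other parameters stay bounded; the constant kernel `S_0` is treated
last.
-/

namespace CliffTM

/-! ### The Euclidean structure of the Clifford algebra -/

instance (m : ℕ) : FiniteDimensional ℝ (Cl m) := (bladeBasis m).finiteDimensional_of_finite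

theorem blade_empty (m : ℕ) : blade (∅ : Finset (Fin m)) = 1 := by simp [blade]

theorem blade_ne_zero {m : ℕ} (T : Finset (Fin m)) : blade T ≠ 0 := by
  rw [← bladeBasis_apply]; exact (bladeBasis m).ne_zero T

/-- Left multiplication by a generator sends an increasing product of generators to a signed one,
with the index removed or inserted. -/
theorem gen_mul_sorted_list {m : ℕ} (i : Fin m) : ∀ l : List (Fin m), l.Pairwise (· < ·) →
    ∃ (ε : ℝ) (l' : List (Fin m)), ε * ε = 1 ∧ l'.Pairwise (· < ·) ∧
      (∀ j, j ∈ l' ↔ (j ∈ l ∧ j ≠ i) ∨ (j = i ∧ j ∉ l)) ∧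
      gen i * (l.map gen).prod = ε • (l'.map gen).prod
  | [], _ => ⟨1, [i], by simp, by simp, by simp, by simp⟩
  | h :: t, hl => by
    rw [List.pairwise_cons] at hl
    rcases lt_trichotomy i h with hi | hi | hi
    · refine ⟨1, i :: h :: t, by simp, List.pairwise_cons.2 ⟨?_, List.pairwise_cons.2 hl⟩, ?_,
        by simp⟩
      · intro b hb
        rcases List.mem_cons.1 hb with rfl | hb
        · exact hi
        · exact hi.trans (hl.1 b hb)
      · intro j
        have : i ∉ t := fun hit => lt_asymm hi (hl.1 i hit)
        have := hi.ne
        simp only [List.mem_cons]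
        grind
    · subst hi
      refine ⟨-1, t, by simp, hl.2, ?_, ?_⟩
      · intro j
        have : i ∉ t := fun hit => lt_irrefl _ (hl.1 i hit)
        simp only [List.mem_cons]
        grind
      · rw [List.map_cons, List.prod_cons, ← mul_assoc, gen_mul_self]; simp
    · obtain ⟨ε, l', h0, h1, h2, h3⟩ := gen_mul_sorted_list i t hl.2
      refine ⟨-ε, h :: l', by linarith, List.pairwise_cons.2 ⟨?_, h1⟩, ?_, ?_⟩
      · intro b hb
        rcases (h2 b).1 hb with hb | hb
        · exact hl.1 b hb.1
        · rw [hb.1]; exact hi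
      · intro j
        have := h2 j
        have := hi.ne
        simp only [List.mem_cons]
        grind
      · rw [List.map_cons, List.prod_cons, ← mul_assoc, gen_mul_gen hi.ne', neg_mul, mul_assoc, h3]
        simp

/-- Left multiplication by a generator permutes the blades up to sign. -/
theorem gen_mul_blade {m : ℕ} (i : Fin m) (T : Finset (Fin m)) :
    ∃ ε : ℝ, ε * ε = 1 ∧ gen i * blade T = ε • blade (symmDiff T {i}) := by
  obtain ⟨ε, l', h0, h1, h2, h3⟩ := gen_mul_sorted_list i _ (Finset.sortedLT_sort T).pairwise
  refine ⟨ε, h0, ?_⟩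
  have hT : l'.toFinset = symmDiff T {i} := by
    ext j
    rw [List.mem_toFinset, h2 j, Finset.mem_symmDiff, Finset.mem_sort, Finset.mem_singleton]
  have hl : (symmDiff T {i}).sort (· ≤ ·) = l' := by
    rw [← hT]
    exact (List.toFinset_sort (· ≤ ·) (h1.imp ne_of_lt)).2 (h1.imp le_of_lt)
  rw [blade, h3, blade, hl]

/-- The Euclidean inner product `∑ x_T y_T` of the coordinates, as a bilinear form. -/
noncomputable def ip (m : ℕ) : Cl m →ₗ[ℝ] Cl m →ₗ[ℝ] ℝ :=
  (innerₗ (EuclideanSpace ℝ (Finset (Fin m)))).compl₁₂ (coords m).toLinearMap (coords m).toLinearMap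

theorem ip_apply {m : ℕ} (x y : Cl m) :
    ip m x y = ∑ T, (bladeBasis m).repr x T * (bladeBasis m).repr y T := by
  simp [ip, coords, PiLp.inner_apply, mul_comm]

theorem ip_self {m : ℕ} (x : Cl m) : ip m x x = ‖x‖ ^ 2 := by
  rw [norm_def, Real.sq_sqrt (Finset.sum_nonneg fun _ _ => sq_nonneg _), ip_apply]
  simp [sq]

theorem ip_blade {m : ℕ} (S T : Finset (Fin m)) :
    ip m (blade S) (blade T) = if S = T then 1 else 0 := by
  rw [ip_apply, ← bladeBasis_apply, ← bladeBasis_apply]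
  simp [Finsupp.single_apply]

theorem ip_gen_mul {m : ℕ} (i : Fin m) (x y : Cl m) :
    ip m (gen i * x) y = -ip m x (gen i * y) := by
  have key : (ip m).comp (LinearMap.mulLeft ℝ (gen i))
      = -(ip m).compl₂ (LinearMap.mulLeft ℝ (gen i)) := by
    refine LinearMap.ext_basis (bladeBasis m) (bladeBasis m) fun S T => ?_
    simp only [bladeBasis_apply, LinearMap.comp_apply, LinearMap.neg_apply,
      LinearMap.compl₂_apply, LinearMap.mulLeft_apply]
    obtain ⟨ε, hε1, hε⟩ := gen_mul_blade i S
    obtain ⟨δ, -, hδ⟩ := gen_mul_blade i T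
    rw [hε, hδ, map_smul, LinearMap.smul_apply, map_smul, ip_blade, ip_blade]
    by_cases h : symmDiff S {i} = T
    · have h' : S = symmDiff T {i} := by rw [← h, symmDiff_symmDiff_cancel_right]
      have : ε * δ = -1 := by
        have h3 : gen i * (gen i * blade S) = (ε * δ) • blade S := by
          rw [hε, mul_smul_comm, h, hδ, smul_smul, ← h']
        rw [← mul_assoc, gen_mul_self, neg_one_mul, ← neg_one_smul ℝ] at h3
        exact (smul_left_injective ℝ (blade_ne_zero S) h3).symm
      rw [if_pos h, if_pos h', smul_eq_mul, smul_eq_mul]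
      linear_combination ε * this - δ * hε1
    · have h' : S ≠ symmDiff T {i} := fun h' => h (by rw [h', symmDiff_symmDiff_cancel_right])
      simp [h, h']
  simpa using congrArg (fun B => B x y) key

/-- Left multiplications are adjoint to left multiplications by the conjugate: the Euclidean
structure makes `Cl m` a `*`-representation of itself. -/
theorem ip_mul {m : ℕ} (c x y : Cl m) : ip m (c * x) y = ip m x (star c * y) := by
  induction c using CliffordAlgebra.induction generalizing x y with
  | algebraMap r => simp [Algebra.algebraMap_eq_smul_one]
  | add a b ha hb => simp [add_mul, ha, hb]
  | mul a b ha hb => rw [mul_assoc, ha, hb, star_mul, mul_assoc]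
  | ι v =>
    have hv : CliffordAlgebra.ι (negForm m) v = ∑ i, v i • gen i := by
      conv_lhs => rw [pi_eq_sum_univ' v]
      simp only [map_sum, map_smul, gen]
    rw [CliffordAlgebra.star_ι, hv]
    simp [Finset.sum_mul, ip_gen_mul]

theorem Sc_eq_ip {m : ℕ} (x : Cl m) : Sc x = ip m 1 x := by
  rw [ip_apply, ← blade_empty, ← bladeBasis_apply]
  simp [Sc, Finsupp.single_apply]

theorem Sc_star_mul {m : ℕ} (x y : Cl m) : Sc (star x * y) = ip m x y := by
  rw [Sc_eq_ip, ← ip_mul, mul_one]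

theorem Sc_star_mul_self {m : ℕ} (x : Cl m) : Sc (star x * x) = ‖x‖ ^ 2 := by
  rw [Sc_star_mul, ip_self]

/-- The scalar part as a linear form. -/
noncomputable def ScL (m : ℕ) : Cl m →L[ℝ] ℝ := LinearMap.toContinuousLinearMap (ip m 1)

theorem ScL_apply {m : ℕ} (x : Cl m) : ScL m x = Sc x := (Sc_eq_ip x).symm

/-- The multiplication of the Clifford algebra as a continuous bilinear map. -/
noncomputable def mulB (m : ℕ) : Cl m →L[ℝ] Cl m →L[ℝ] Cl m :=
  (LinearMap.mul ℝ (Cl m)).toContinuousBilinearMap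

@[simp] theorem mulB_apply {m : ℕ} (x y : Cl m) : mulB m x y = x * y := rfl

/-- The conjugation of the Clifford algebra as a continuous linear map. -/
noncomputable def starL (m : ℕ) : Cl m →L[ℝ] Cl m :=
  LinearMap.toContinuousLinearMap
    { toFun := star
      map_add' := star_add
      map_smul' := fun r x => CliffordAlgebra.star_smul r x }

@[simp] theorem starL_apply {m : ℕ} (x : Cl m) : starL m x = star x := rfl

instance (m : ℕ) : ContinuousMul (Cl m) :=
  ⟨(mulB m).isBoundedBilinearMap.continuous⟩

instance (m : ℕ) : ContinuousStar (Cl m) := ⟨(starL m).continuous⟩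

theorem norm_one_Cl (m : ℕ) : ‖(1 : Cl m)‖ = 1 := by
  have h := ip_self (1 : Cl m)
  rw [← blade_empty, ip_blade, if_pos rfl] at h
  rw [← blade_empty]
  exact (pow_eq_one_iff_of_nonneg (norm_nonneg _) two_ne_zero).1 h.symm

/-- A Clifford number `c` such that `c v = 0` only for `v = 0` is invertible. -/
theorem isUnit_of_mul_injective {m : ℕ} {c : Cl m} (h : ∀ v, c * v = 0 → v = 0) : IsUnit c := by
  have h1 : Function.Injective (LinearMap.mulLeft ℝ c) :=
    (injective_iff_map_eq_zero (LinearMap.mulLeft ℝ c)).2 h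
  obtain ⟨d, hd⟩ := LinearMap.surjective_of_injective h1 1
  have hd : c * d = 1 := hd
  refine ⟨⟨c, d, hd, ?_⟩, rfl⟩
  have := h (d * c - 1) (by rw [mul_sub, ← mul_assoc, hd]; simp)
  exact sub_eq_zero.1 this

/-! ### Paravectors -/

theorem star_gen {m : ℕ} (i : Fin m) : star (gen i : Cl m) = -gen i := CliffordAlgebra.star_ι _

@[simp] theorem e_zero {m : ℕ} : (e 0 : Cl m) = 1 := rfl

@[simp] theorem e_succ {m : ℕ} (j : Fin m) : (e j.succ : Cl m) = gen j := rfl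

theorem star_e_mul_self {m : ℕ} (i : Fin (m + 1)) : star (e i : Cl m) * e i = 1 := by
  cases i using Fin.cases with
  | zero => simp
  | succ j => simp [star_gen, gen_mul_self]

theorem e_mul_star_self {m : ℕ} (i : Fin (m + 1)) : (e i : Cl m) * star (e i) = 1 := by
  cases i using Fin.cases with
  | zero => simp
  | succ j => simp [star_gen, gen_mul_self]

theorem star_e_mul_e {m : ℕ} {i j : Fin (m + 1)} (h : i ≠ j) :
    star (e i : Cl m) * e j = -(star (e j) * e i) := by
  cases i using Fin.cases with
  | zero =>
    cases j using Fin.cases with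
    | zero => exact absurd rfl h
    | succ j => simp [star_gen]
  | succ i =>
    cases j using Fin.cases with
    | zero => simp [star_gen]
    | succ j =>
      have : i ≠ j := fun hij => h (by rw [hij])
      simp [star_gen, gen_mul_gen this]

theorem e_mul_star_e {m : ℕ} {i j : Fin (m + 1)} (h : i ≠ j) :
    (e i : Cl m) * star (e j) = -(e j * star (e i)) := by
  cases i using Fin.cases with
  | zero =>
    cases j using Fin.cases with
    | zero => exact absurd rfl h
    | succ j => simp [star_gen]
  | succ i =>
    cases j using Fin.cases with
    | zero => simp [star_gen]
    | succ j =>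
      have : i ≠ j := fun hij => h (by rw [hij])
      simp [star_gen, gen_mul_gen this]

/-- The embedding of paravectors as a continuous linear map. -/
noncomputable def paraL (m : ℕ) : E m →L[ℝ] Cl m :=
  LinearMap.toContinuousLinearMap
    { toFun := para
      map_add' := fun x y => by simp [para, add_smul, Finset.sum_add_distrib]
      map_smul' := fun r x => by simp [para, Finset.smul_sum, smul_smul] }

@[simp] theorem paraL_apply {m : ℕ} (x : E m) : paraL m x = para x := rfl

theorem para_smul {m : ℕ} (r : ℝ) (x : E m) : para (r • x) = r • para x := (paraL m).map_smul r x

theorem para_sub {m : ℕ} (x y : E m) : para (x - y) = para x - para y := (paraL m).map_sub x y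

theorem para_single {m : ℕ} (i : Fin (m + 1)) : para (EuclideanSpace.single i 1) = (e i : Cl m) := by
  simp [para]

theorem star_para {m : ℕ} (x : E m) : star (para x) = ∑ i, x i • star (e i : Cl m) := by
  rw [← starL_apply, para]; simp

/-- A double sum whose off-diagonal part is antisymmetric is its diagonal part. -/
theorem sum_antisymm {ι M : Type*} [Fintype ι] [AddCommGroup M] [Module ℝ M] (g : ι → ι → M)
    (c : M) (h : ∀ i j, i ≠ j → g i j = -g j i) (hd : ∑ i, g i i = c) :
    ∑ i, ∑ j, g i j = c := by
  classical
  have h1 : ∑ i, ∑ j, (g i j + g j i) = (2 : ℝ) • c := by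
    rw [← hd, Finset.smul_sum]
    refine Finset.sum_congr rfl fun i _ => ?_
    rw [Finset.sum_eq_single i]
    · rw [two_smul]
    · intro j _ hj; rw [h i j hj.symm, neg_add_cancel]
    · simp
  simp only [Finset.sum_add_distrib] at h1
  rw [Finset.sum_comm (f := fun i j => g j i), ← two_smul ℝ] at h1
  exact smul_right_injective M (two_ne_zero (α := ℝ)) h1

theorem star_para_mul_para {m : ℕ} (x : E m) : star (para x) * para x = (‖x‖ ^ 2) • (1 : Cl m) := by
  rw [star_para, para, Finset.sum_mul]
  simp only [Finset.mul_sum, smul_mul_smul_comm]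
  refine sum_antisymm _ _ (fun i j h => ?_) ?_
  · rw [star_e_mul_e h, smul_neg, mul_comm]
  · simp_rw [star_e_mul_self, ← Finset.sum_smul, EuclideanSpace.norm_sq_eq, Real.norm_eq_abs,
      sq_abs, ← sq]

theorem para_mul_star_para {m : ℕ} (x : E m) : para x * star (para x) = (‖x‖ ^ 2) • (1 : Cl m) := by
  rw [star_para, para, Finset.sum_mul]
  simp only [Finset.mul_sum, smul_mul_smul_comm]
  refine sum_antisymm _ _ (fun i j h => ?_) ?_
  · rw [e_mul_star_e h, smul_neg, mul_comm]
  · simp_rw [e_mul_star_self, ← Finset.sum_smul, EuclideanSpace.norm_sq_eq, Real.norm_eq_abs,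
      sq_abs, ← sq]

theorem norm_para_mul {m : ℕ} (x : E m) (c : Cl m) : ‖para x * c‖ = ‖x‖ * ‖c‖ := by
  have : ‖para x * c‖ ^ 2 = (‖x‖ * ‖c‖) ^ 2 := by
    rw [← ip_self, ip_mul, ← mul_assoc, star_para_mul_para, smul_one_mul, map_smul, ip_self,
      mul_pow, smul_eq_mul]
  exact (pow_left_inj₀ (norm_nonneg _) (by positivity) two_ne_zero).1 this

theorem norm_para {m : ℕ} (x : E m) : ‖(para x : Cl m)‖ = ‖x‖ := by
  simpa [norm_one_Cl] using norm_para_mul x 1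

open scoped RealInnerProductSpace in
theorem star_para_mul_add {m : ℕ} (a x : E m) :
    star (para a) * para x + star (para x) * para a = (2 * ⟪a, x⟫) • (1 : Cl m) := by
  have h := star_para_mul_para (a + x)
  rw [← paraL_apply, map_add, paraL_apply, paraL_apply, star_add, add_mul, mul_add, mul_add,
    star_para_mul_para, star_para_mul_para, norm_add_sq_real, add_smul, add_smul] at h
  rw [← sub_eq_zero] at h ⊢
  rw [← h]
  abel
open scoped RealInnerProductSpace

/-! ### Szegő kernels are monogenic -/

/-- The polynomial `1 - 2⟨a, x⟩ + |a|²|x|²`, which is the square of `|1 - \bar a x|`. -/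
noncomputable def szegoDen {m : ℕ} (a x : E m) : ℝ := 1 - 2 * ⟪a, x⟫ + ‖a‖ ^ 2 * ‖x‖ ^ 2

theorem star_one_sub {m : ℕ} (a x : E m) :
    star (1 - star (para a) * para x : Cl m) = 1 - star (para x) * para a := by
  simp

theorem star_one_sub_mul_one_sub {m : ℕ} (a x : E m) :
    (1 - star (para x) * para a : Cl m) * (1 - star (para a) * para x)
      = szegoDen a x • (1 : Cl m) := by
  have h1 := star_para_mul_add a x
  have h2 : (star (para x) * para a : Cl m) * (star (para a) * para x)
      = (‖a‖ ^ 2 * ‖x‖ ^ 2) • (1 : Cl m) := by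
    rw [mul_assoc, ← mul_assoc (para a), para_mul_star_para, smul_one_mul, mul_smul_comm,
      star_para_mul_para, smul_smul]
  rw [szegoDen, add_smul, sub_smul, ← h1, ← h2, one_smul]
  noncomm_ring

theorem one_sub_mul_star_one_sub {m : ℕ} (a x : E m) :
    (1 - star (para a) * para x : Cl m) * (1 - star (para x) * para a)
      = szegoDen a x • (1 : Cl m) := by
  have := star_one_sub_mul_one_sub x a
  rwa [szegoDen, real_inner_comm, mul_comm (‖x‖ ^ 2)] at this

theorem norm_one_sub_sq {m : ℕ} (a x : E m) :
    ‖(1 - star (para a) * para x : Cl m)‖ ^ 2 = szegoDen a x := by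
  rw [← Sc_star_mul_self, star_one_sub, star_one_sub_mul_one_sub, Sc_eq_ip, map_smul, ip_self,
    norm_one_Cl]
  simp

theorem szegoDen_nonneg {m : ℕ} (a x : E m) : 0 ≤ szegoDen a x := by
  rw [← norm_one_sub_sq]; positivity

theorem szegoDen_pos {m : ℕ} {a x : E m} (h : ‖a‖ * ‖x‖ < 1) : 0 < szegoDen a x := by
  have h1 := real_inner_le_norm a x
  unfold szegoDen
  nlinarith [mul_pos (sub_pos.2 h) (sub_pos.2 h)]

theorem szego_eq {m : ℕ} (a x : E m) :
    szego a x = szegoDen a x ^ (-((m : ℝ) + 1) / 2) • (1 - star (para x) * para a : Cl m) := by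
  rw [szego, star_one_sub]
  congr 1
  have h1 : ‖(1 - star (para a) * para x : Cl m)‖ = √(szegoDen a x) := by
    rw [← norm_one_sub_sq, Real.sqrt_sq (norm_nonneg _)]
  rw [h1, neg_div, Real.rpow_neg (szegoDen_nonneg a x), Real.sqrt_eq_rpow, ← Real.rpow_natCast,
    ← Real.rpow_mul (szegoDen_nonneg a x)]
  congr 2
  push_cast
  ring

theorem contDiff_szegoDen {m : ℕ} (a : E m) {n : WithTop ℕ∞} : ContDiff ℝ n (szegoDen a) := by
  have h1 : ContDiff ℝ n fun x : E m => ⟪a, x⟫ := (innerSL ℝ a).contDiff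
  exact (contDiff_const.sub (contDiff_const.mul h1)).add
    (contDiff_const.mul (contDiff_id.norm_sq ℝ))

/-- The linear map `x ↦ \bar x a`. -/
noncomputable def starParaMulL {m : ℕ} (a : E m) : E m →L[ℝ] Cl m :=
  ((mulB m).flip (para a)).comp ((starL m).comp (paraL m))

@[simp] theorem starParaMulL_apply {m : ℕ} (a x : E m) :
    starParaMulL a x = star (para x) * para a := rfl

theorem contDiffAt_szego {m : ℕ} {a x : E m} {n : WithTop ℕ∞} (h : szegoDen a x ≠ 0) :
    ContDiffAt ℝ n (szego a) x := by
  have : szego a = fun x => szegoDen a x ^ (-((m : ℝ) + 1) / 2) • (1 - starParaMulL a x) :=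
    funext fun x => szego_eq a x
  rw [this]
  exact ((contDiff_szegoDen a).contDiffAt.rpow_const_of_ne h).smul
    (contDiffAt_const.sub (starParaMulL a).contDiff.contDiffAt)

/-- Szegő kernels are monogenic off their poles. -/
theorem dirac_szego {m : ℕ} {a x : E m} (h : szegoDen a x ≠ 0) : dirac (szego a) x = 0 := by
  set p : ℝ := -((m : ℝ) + 1) / 2 with hp
  have hQ : HasFDerivAt (szegoDen a)
      (-((2 : ℝ) • innerSL ℝ a) + (‖a‖ ^ 2) • ((2 : ℝ) • innerSL ℝ x)) x := by
    have h1 : HasFDerivAt (fun x : E m => ⟪a, x⟫) (innerSL ℝ a) x := (innerSL ℝ a).hasFDerivAt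
    have h2 : HasFDerivAt (fun x : E m => ‖x‖ ^ 2) ((2 : ℝ) • innerSL ℝ x) x :=
      (hasStrictFDerivAt_norm_sq x).hasFDerivAt.congr_fderiv (by ext; simp)
    exact ((h1.const_mul 2).const_sub 1).add (h2.const_mul (‖a‖ ^ 2))
  have hf := (hQ.rpow_const (p := p) (Or.inl h)).smul
    ((starParaMulL a).hasFDerivAt (x := x) |>.const_sub (1 : Cl m))
  have hfd := (hf.congr_of_eventuallyEq (Eventually.of_forall fun x => szego_eq a x)).fderiv
  rw [dirac, hfd]
  have hq : ∀ i : Fin (m + 1), (e i : Cl m) * (star (e i) * para a) = para a := fun i => by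
    rw [← mul_assoc, e_mul_star_self, one_mul]
  have hpow : szegoDen a x ^ p = szegoDen a x ^ (p - 1) * szegoDen a x := by
    rw [Real.rpow_sub_one h, div_mul_cancel₀ _ h]
  -- `a (1 - \bar a x) = a - |a|² x`, which is where the gradient of the denominator points
  have hgrad : ∑ i, (2 * (‖a‖ ^ 2 * x i - a i)) • (e i : Cl m)
      = (-2 : ℝ) • (para a * (1 - star (para a) * para x)) := by
    rw [mul_sub, ← mul_assoc, para_mul_star_para, mul_one, smul_one_mul, para, para,
      Finset.smul_sum, ← Finset.sum_sub_distrib, Finset.smul_sum]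
    refine Finset.sum_congr rfl fun i _ => ?_
    module
  have hsum : ∀ i : Fin (m + 1), (e i : Cl m) * ((szegoDen a x ^ p • -starParaMulL a +
      ((p * szegoDen a x ^ (p - 1)) •
        (-((2 : ℝ) • innerSL ℝ a) + (‖a‖ ^ 2) • ((2 : ℝ) • innerSL ℝ x))).smulRight
          (1 - starParaMulL a x)) (EuclideanSpace.single i 1))
      = -(szegoDen a x ^ p • para a) + (p * szegoDen a x ^ (p - 1)) •
        ((2 * (‖a‖ ^ 2 * x i - a i)) • e i * (1 - star (para x) * para a)) := fun i => by
    have h3 : (-((2 : ℝ) • innerSL ℝ a) + (‖a‖ ^ 2) • ((2 : ℝ) • innerSL ℝ x))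
        (EuclideanSpace.single i 1) = 2 * (‖a‖ ^ 2 * x i - a i) := by
      simp [EuclideanSpace.inner_single_right]
      ring
    rw [add_apply, smul_apply,
      ContinuousLinearMap.smulRight_apply, smul_apply, h3,
      neg_apply, starParaMulL_apply, starParaMulL_apply, para_single,
      mul_add, mul_smul_comm, mul_neg, hq, smul_neg, mul_smul_comm, smul_mul_assoc, smul_smul,
      smul_eq_mul]
  rw [Finset.sum_congr rfl fun i _ => hsum i, Finset.sum_add_distrib, ← Finset.smul_sum,
    ← Finset.sum_mul, hgrad, smul_mul_assoc, mul_assoc, one_sub_mul_star_one_sub, mul_smul_comm,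
    mul_one, hpow]
  simp only [Finset.sum_const, Finset.card_univ, Fintype.card_fin, ← Nat.cast_smul_eq_nsmul ℝ,
    smul_smul, ← neg_smul, ← add_smul]
  rw [hp]
  push_cast
  convert zero_smul ℝ _ using 2
  ring

/-! ### Right modules of monogenic functions -/

theorem IsLeftMonogenicOn.mono {m : ℕ} {f : E m → Cl m} {U V : Set (E m)}
    (hf : IsLeftMonogenicOn f V) (h : U ⊆ V) : IsLeftMonogenicOn f U :=
  ⟨hf.1.mono h, fun x hx => hf.2 x (h hx)⟩

theorem IsLeftMonogenicOn.differentiableAt {m : ℕ} {f : E m → Cl m} {U : Set (E m)}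
    (hf : IsLeftMonogenicOn f U) (hU : IsOpen U) {x : E m} (hx : x ∈ U) :
    DifferentiableAt ℝ f x :=
  (hf.1.contDiffAt (hU.mem_nhds hx)).differentiableAt one_ne_zero

theorem IsLeftMonogenicOn.mul_const {m : ℕ} {f : E m → Cl m} {U : Set (E m)} (hU : IsOpen U)
    (hf : IsLeftMonogenicOn f U) (c : Cl m) : IsLeftMonogenicOn (fun x => f x * c) U := by
  refine ⟨((mulB m).flip c).contDiff.comp_contDiffOn hf.1, fun x hx => ?_⟩
  have h := ((mulB m).flip c).hasFDerivAt.comp x (hf.differentiableAt hU hx).hasFDerivAt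
  have h' : fderiv ℝ (fun x => f x * c) x = ((mulB m).flip c).comp (fderiv ℝ f x) := h.fderiv
  simp only [dirac, h', ContinuousLinearMap.comp_apply, ContinuousLinearMap.flip_apply, mulB_apply,
    ← mul_assoc]
  rw [← Finset.sum_mul]
  have := hf.2 x hx
  rw [dirac] at this
  rw [this, zero_mul]

theorem IsLeftMonogenicOn.sum {m : ℕ} {ι : Type*} {s : Finset ι} {f : ι → E m → Cl m}
    {U : Set (E m)} (hU : IsOpen U) (hf : ∀ i ∈ s, IsLeftMonogenicOn (f i) U) :
    IsLeftMonogenicOn (fun x => ∑ i ∈ s, f i x) U := by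
  refine ⟨ContDiffOn.sum fun i hi => (hf i hi).1, fun x hx => ?_⟩
  simp only [dirac]
  rw [fderiv_fun_sum fun i hi => (hf i hi).differentiableAt hU hx]
  simp only [sum_apply, Finset.mul_sum]
  rw [Finset.sum_comm]
  exact Finset.sum_eq_zero fun i hi => (hf i hi).2 x hx

/-! ### Rotations and integration over the sphere -/

/-- The map of the unit sphere induced by a linear isometry. -/
noncomputable def sphMap {m : ℕ} (U : E m ≃ₗᵢ[ℝ] E m) (η : Sph m) : Sph m :=
  ⟨U η, by simp⟩

open scoped Pointwise in
theorem measurePreserving_sphMap {m : ℕ} (U : E m ≃ₗᵢ[ℝ] E m) :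
    MeasurePreserving (sphMap U) (surf m) (surf m) := by
  have hc : Continuous (sphMap U) := by
    unfold sphMap
    exact (U.continuous.comp continuous_subtype_val).subtype_mk _
  refine ⟨hc.measurable, Measure.ext fun s hs => ?_⟩
  rw [Measure.map_apply hc.measurable hs, Measure.toSphere_apply' _ hs,
    Measure.toSphere_apply' _ (hc.measurable hs)]
  congr 1
  rw [← U.measurePreserving.measure_preimage_equiv (f := U.toMeasurableEquiv)
    (Set.Ioo (0 : ℝ) 1 • (Subtype.val '' s))]
  congr 1
  ext x
  simp only [Set.mem_smul, Set.mem_image, Set.mem_preimage]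
  constructor
  · rintro ⟨r, hr, _, ⟨η, hη, rfl⟩, rfl⟩
    exact ⟨r, hr, _, ⟨_, hη, rfl⟩, by simp [sphMap]⟩
  · rintro ⟨r, hr, _, ⟨η, hη, rfl⟩, h⟩
    refine ⟨r, hr, _, ⟨sphMap U.symm η, ?_, rfl⟩, ?_⟩
    · convert hη
      ext1
      simp [sphMap]
    · apply U.injective
      simpa [sphMap] using h

/-- The rotation by the angle `t` in the plane of the coordinates `i` and `j`, as a linear map
(it is a rotation only for `i ≠ j`). -/
noncomputable def rotLM {m : ℕ} (i j : Fin (m + 1)) (t : ℝ) : E m →ₗ[ℝ] E m where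
  toFun x := x + (((Real.cos t - 1) * x i - Real.sin t * x j) • EuclideanSpace.single i (1 : ℝ)
    + (Real.sin t * x i + (Real.cos t - 1) * x j) • EuclideanSpace.single j (1 : ℝ))
  map_add' x y := by simp only [PiLp.add_apply]; module
  map_smul' r x := by simp only [PiLp.smul_apply, smul_eq_mul, RingHom.id_apply]; module

theorem norm_rotLM {m : ℕ} {i j : Fin (m + 1)} (h : i ≠ j) (t : ℝ) (x : E m) :
    ‖rotLM i j t x‖ = ‖x‖ := by
  have : ‖rotLM i j t x‖ ^ 2 = ‖x‖ ^ 2 := by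
    simp only [rotLM, LinearMap.coe_mk, AddHom.coe_mk]
    rw [norm_add_sq_real, norm_add_sq_real]
    simp only [inner_add_right, inner_smul_right, inner_smul_left, norm_smul,
      EuclideanSpace.inner_single_right, PiLp.norm_single, mul_pow]
    simp [h.symm]
    linear_combination (x i ^ 2 + x j ^ 2) * Real.sin_sq_add_cos_sq t
  exact (pow_left_inj₀ (norm_nonneg _) (norm_nonneg _) two_ne_zero).1 this

/-- The rotation by the angle `t` in the plane of the coordinates `i` and `j`. -/
noncomputable def rot {m : ℕ} {i j : Fin (m + 1)} (h : i ≠ j) (t : ℝ) : E m ≃ₗᵢ[ℝ] E m :=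
  LinearIsometry.toLinearIsometryEquiv ⟨rotLM i j t, norm_rotLM h t⟩ rfl

theorem rot_apply {m : ℕ} {i j : Fin (m + 1)} (h : i ≠ j) (t : ℝ) (x : E m) :
    rot h t x = x + (((Real.cos t - 1) * x i - Real.sin t * x j) • EuclideanSpace.single i (1 : ℝ)
    + (Real.sin t * x i + (Real.cos t - 1) * x j) • EuclideanSpace.single j (1 : ℝ)) := rfl

/-- The velocity at time `t` of a point moved by the rotations `rot`. -/
noncomputable def rotVel {m : ℕ} (i j : Fin (m + 1)) (t : ℝ) (x : E m) : E m :=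
  (-Real.sin t * x i - Real.cos t * x j) • EuclideanSpace.single i (1 : ℝ)
    + (Real.cos t * x i + -Real.sin t * x j) • EuclideanSpace.single j (1 : ℝ)

theorem hasDerivAt_rot {m : ℕ} {i j : Fin (m + 1)} (h : i ≠ j) (t : ℝ) (x : E m) :
    HasDerivAt (fun t => rot h t x) (rotVel i j t x) t := by
  have hs := Real.hasDerivAt_sin t
  have hc := Real.hasDerivAt_cos t
  exact ((((((hc.sub_const 1).mul_const (x i)).sub (hs.mul_const (x j))).smul_const _).add
    (((hs.mul_const (x i)).add ((hc.sub_const 1).mul_const (x j))).smul_const _))).const_add x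

/-- The vector field `x_i ∂_j - x_j ∂_i`, which is tangent to the spheres. -/
noncomputable def angVec {m : ℕ} (i j : Fin (m + 1)) (x : E m) : E m :=
  x i • EuclideanSpace.single j (1 : ℝ) - x j • EuclideanSpace.single i (1 : ℝ)

theorem rotVel_zero {m : ℕ} (i j : Fin (m + 1)) (x : E m) : rotVel i j 0 x = angVec i j x := by
  simp [rotVel, angVec]
  abel

/-- Differentiation of an integral over a compact space with respect to a parameter. -/
theorem hasDerivAt_integral_of_compactSpace {α G : Type*} [TopologicalSpace α] [CompactSpace α]
    [MeasurableSpace α] [BorelSpace α] [SecondCountableTopology α] [NormedAddCommGroup G]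
    [NormedSpace ℝ G] (μ : Measure α) [IsFiniteMeasure μ] {S : Set ℝ} (hS : IsOpen S)
    {F F' : ℝ → α → G} (hF : ContinuousOn (Function.uncurry F) (S ×ˢ Set.univ))
    (hF' : ContinuousOn (Function.uncurry F') (S ×ˢ Set.univ))
    (hd : ∀ t ∈ S, ∀ x, HasDerivAt (fun t => F t x) (F' t x) t) {t : ℝ} (ht : t ∈ S) :
    HasDerivAt (fun t => ∫ x, F t x ∂μ) (∫ x, F' t x ∂μ) t := by
  have slice : ∀ {H : ℝ → α → G}, ContinuousOn (Function.uncurry H) (S ×ˢ Set.univ) →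
      ∀ s ∈ S, Continuous (H s) := fun {H} hH s hs =>
    hH.comp_continuous (f := fun x => (s, x)) (by fun_prop) fun x => ⟨hs, trivial⟩
  obtain ⟨δ, hδ, hball⟩ := Metric.nhds_basis_closedBall.mem_iff.1 (hS.mem_nhds ht)
  have hcomp : IsCompact (Metric.closedBall t δ ×ˢ (Set.univ : Set α)) :=
    (isCompact_closedBall t δ).prod isCompact_univ
  obtain ⟨C, hC⟩ := hcomp.exists_bound_of_continuousOn
    (hF'.mono (Set.prod_mono hball subset_rfl))
  refine (hasDerivAt_integral_of_dominated_loc_of_deriv_le (bound := fun _ => C)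
    (Metric.ball_mem_nhds t hδ) ?_ ?_ ?_ ?_ ?_ ?_).2
  · filter_upwards [hS.mem_nhds ht] with s hs
    exact (slice hF s hs).aestronglyMeasurable
  · exact (slice hF t ht).integrable_of_hasCompactSupport (HasCompactSupport.of_compactSpace _)
  · exact (slice hF' t ht).aestronglyMeasurable
  · exact Eventually.of_forall fun x s hs =>
      hC (s, x) ⟨Metric.ball_subset_closedBall hs, trivial⟩
  · exact integrable_const C
  · exact Eventually.of_forall fun x s hs =>
      hd s (hball (Metric.ball_subset_closedBall hs)) x

/-- Tangential derivatives of a function along rotations have integral zero over the sphere. -/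
theorem integral_fderiv_angVec {m : ℕ} {G : Type*} [NormedAddCommGroup G] [NormedSpace ℝ G]
    {V : Set (E m)} (hV : IsOpen V) (hVs : Metric.sphere (0 : E m) 1 ⊆ V) {H : E m → G}
    (hH : ContDiffOn ℝ 1 H V) (i j : Fin (m + 1)) :
    ∫ η : Sph m, fderiv ℝ H η (angVec i j η) ∂(surf m) = 0 := by
  by_cases h : i = j
  · subst h; simp [angVec]
  have hmem : ∀ (t : ℝ) (η : Sph m), rot h t η ∈ V := fun t η => hVs (by simp)
  have hrot : Continuous fun p : ℝ × Sph m => rot h p.1 (p.2 : E m) := by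
    simp only [rot_apply]
    fun_prop
  have hvel : Continuous fun p : ℝ × Sph m => rotVel i j p.1 (p.2 : E m) := by
    simp only [rotVel]
    fun_prop
  have hd := hasDerivAt_integral_of_compactSpace (surf m) isOpen_univ
    (F := fun t (η : Sph m) => H (rot h t η))
    (F' := fun t (η : Sph m) => fderiv ℝ H (rot h t η) (rotVel i j t η))
    (hH.continuousOn.comp_continuous hrot fun p => hmem p.1 p.2).continuousOn
    (((hH.continuousOn_fderiv_of_isOpen hV le_rfl).comp_continuous hrot
      fun p => hmem p.1 p.2).clm_apply hvel).continuousOn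
    (fun t _ η => ((hH.contDiffAt (hV.mem_nhds (hmem t η))).differentiableAt
      one_ne_zero).hasFDerivAt.comp_hasDerivAt t (hasDerivAt_rot h t η)) (Set.mem_univ 0)
  have hconst : ∀ t, ∫ η : Sph m, H (rot h t η) ∂(surf m) = ∫ η : Sph m, H η ∂(surf m) :=
    fun t => by
      have hHc : Continuous fun η : Sph m => H η :=
        hH.continuousOn.comp_continuous continuous_subtype_val fun η => hVs η.2
      have hmp := measurePreserving_sphMap (rot h t)
      conv_rhs => rw [← hmp.map_eq, integral_map hmp.measurable.aemeasurable
        hHc.aestronglyMeasurable]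
      rfl
  simp only [hconst] at hd
  have := hd.unique (hasDerivAt_const _ _)
  have h0 : ∀ x : E m, rot h 0 x = x := fun x => by simp [rot_apply]
  simpa [h0, rotVel_zero] using this

/-! ### Symmetry of the Euler operator on the sphere -/

theorem fderiv_angVec {m : ℕ} (A : E m →L[ℝ] Cl m) (i j : Fin (m + 1)) (x : E m) :
    A (angVec i j x) = x i • A (EuclideanSpace.single j 1) - x j • A (EuclideanSpace.single i 1) := by
  simp [angVec]

theorem star_e_mul_e_add {m : ℕ} (i j : Fin (m + 1)) :
    star (e i : Cl m) * e j + star (e j) * e i = if i = j then 2 else 0 := by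
  split_ifs with h
  · subst h; rw [star_e_mul_self]; norm_num
  · rw [star_e_mul_e h, neg_add_cancel]

/-- On a monogenic function the Euler operator `∑ x_i ∂_i` is an angular operator: multiply the
Cauchy–Riemann equation by `\bar x` and separate the antisymmetric part of `\bar e_i e_j`. -/
theorem fderiv_self_of_dirac_eq_zero {m : ℕ} {f : E m → Cl m} {x : E m} (h : dirac f x = 0) :
    fderiv ℝ f x x = -((1 / 2 : ℝ) • ∑ i, ∑ j,
      star (e i) * e j * fderiv ℝ f x (angVec i j x)) := by
  set A := fderiv ℝ f x with hA
  have hx : A x = ∑ i, x i • A (EuclideanSpace.single i 1) := by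
    conv_lhs => rw [← (EuclideanSpace.basisFun (Fin (m + 1)) ℝ).sum_repr x]
    simp
  have h0 : ∑ j, (e j : Cl m) * A (EuclideanSpace.single j 1) = 0 := h
  have h1 : ∑ i, ∑ j, x i • (star (e i : Cl m) * e j * A (EuclideanSpace.single j 1)) = 0 := by
    refine Finset.sum_eq_zero fun i _ => ?_
    simp only [mul_assoc]
    rw [← Finset.smul_sum, ← Finset.mul_sum, h0, mul_zero, smul_zero]
  have h2 : ∑ i, ∑ j, x j • ((star (e i : Cl m) * e j + star (e j) * e i) *
      A (EuclideanSpace.single i 1)) = (2 : ℝ) • A x := by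
    rw [hx, Finset.smul_sum]
    refine Finset.sum_congr rfl fun i _ => ?_
    simp only [star_e_mul_e_add]
    simp [two_mul, two_smul]
  have h3 : ∑ i, ∑ j, x j • (star (e j : Cl m) * e i * A (EuclideanSpace.single i 1)) = 0 := by
    rw [Finset.sum_comm]; exact h1
  have h4 : ∑ i, ∑ j, x j • (star (e i : Cl m) * e j * A (EuclideanSpace.single i 1))
      = (2 : ℝ) • A x := by
    rw [← h2]
    simp only [add_mul, smul_add, Finset.sum_add_distrib]
    rw [h3, add_zero]
  simp only [fderiv_angVec, mul_sub, mul_smul_comm, Finset.sum_sub_distrib]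
  rw [h1, h4, zero_sub, smul_neg, neg_neg, smul_smul]
  norm_num

/-- For monogenic functions near the sphere the Euler operator is symmetric with respect to the
Clifford-valued inner product, because the angular operators are skew. -/
theorem integral_euler_sub_eq_zero {m : ℕ} {f g : E m → Cl m} {V : Set (E m)} (hV : IsOpen V)
    (hVs : Metric.sphere (0 : E m) 1 ⊆ V) (hf : IsLeftMonogenicOn f V)
    (hg : IsLeftMonogenicOn g V) :
    ∫ η : Sph m, (star (fderiv ℝ f η η) * g η - star (f η) * fderiv ℝ g η η) ∂(surf m) = 0 := by
  set c : Fin (m + 1) → Fin (m + 1) → Cl m := fun i j => star (e i) * e j with hc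
  set H : Fin (m + 1) → Fin (m + 1) → E m → Cl m := fun i j x => star (f x) * (c i j * g x) with hH
  have hHc : ∀ i j, ContDiffOn ℝ 1 (H i j) V := fun i j =>
    (mulB m).isBoundedBilinearMap.contDiff.comp_contDiffOn
      (((starL m).contDiff.comp_contDiffOn hf.1).prodMk
        ((mulB m (c i j)).contDiff.comp_contDiffOn hg.1))
  have hHd : ∀ i j, ∀ x ∈ V, ∀ w, fderiv ℝ (H i j) x w
      = star (fderiv ℝ f x w) * (c i j * g x) + star (f x) * (c i j * fderiv ℝ g x w) := by
    intro i j x hx w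
    have h1 := (starL m).hasFDerivAt.comp x (hf.differentiableAt hV hx).hasFDerivAt
    have h2 := (mulB m (c i j)).hasFDerivAt.comp x (hg.differentiableAt hV hx).hasFDerivAt
    have h3 := (mulB m).hasFDerivAt_of_bilinear h1 h2
    have h4 : fderiv ℝ (H i j) x = _ := h3.fderiv
    rw [h4]
    simp [add_comm]
  have key : ∀ η : Sph m, star (fderiv ℝ f η η) * g η - star (f η) * fderiv ℝ g η η
      = (1 / 2 : ℝ) • ∑ i, ∑ j, fderiv ℝ (H i j) η (angVec i j η) := by
    intro η
    have hη : (η : E m) ∈ V := hVs η.2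
    rw [fderiv_self_of_dirac_eq_zero (hf.2 η hη), fderiv_self_of_dirac_eq_zero (hg.2 η hη)]
    simp only [hHd _ _ η hη, ← starL_apply, map_neg, map_smul, map_sum, neg_mul, mul_neg,
      Finset.sum_mul, Finset.mul_sum, smul_mul_assoc, mul_smul_comm]
    rw [sub_neg_eq_add, Finset.sum_congr rfl fun i _ => Finset.sum_add_distrib,
      Finset.sum_add_distrib, smul_add, ← smul_neg]
    simp only [← Finset.sum_neg_distrib]
    congr 2
    refine Finset.sum_congr rfl fun i _ => Finset.sum_congr rfl fun j _ => ?_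
    by_cases h : i = j
    · subst h; simp [angVec]
    · have : star (star (e i : Cl m) * e j) = -c i j := by
        simp only [hc, star_mul, star_star]
        rw [star_e_mul_e h, neg_neg]
      rw [starL_apply, starL_apply, star_mul, this, mul_neg, neg_mul, neg_neg, mul_assoc,
        starL_apply]
  have hint : ∀ i j, Integrable (fun η : Sph m => fderiv ℝ (H i j) η (angVec i j η)) (surf m) :=
    fun i j => by
      have hcont : Continuous fun η : Sph m => fderiv ℝ (H i j) η (angVec i j η) :=
        (((hHc i j).continuousOn_fderiv_of_isOpen hV le_rfl).comp_continuous
          continuous_subtype_val fun η => hVs η.2).clm_apply (by unfold angVec; fun_prop)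
      exact hcont.integrable_of_hasCompactSupport (HasCompactSupport.of_compactSpace _)
  simp only [key]
  rw [integral_smul, integral_finsetSum _ fun i _ => integrable_finsetSum _ fun j _ => hint i j,
    Finset.sum_eq_zero, smul_zero]
  intro i _
  rw [integral_finsetSum _ fun j _ => hint i j]
  exact Finset.sum_eq_zero fun j _ => integral_fderiv_angVec hV hVs (hHc i j) i j

theorem IsLeftMonogenicOn.comp_smul {m : ℕ} {f : E m → Cl m} {U : Set (E m)}
    (hf : IsLeftMonogenicOn f U) (r : ℝ) :
    IsLeftMonogenicOn (fun x => f (r • x)) ((fun x => r • x) ⁻¹' U) := by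
  refine ⟨hf.1.comp (contDiff_const_smul r).contDiffOn fun x hx => hx, fun x hx => ?_⟩
  simp only [dirac, fderiv_comp_smul, smul_apply, mul_smul_comm]
  rw [← Finset.smul_sum]
  have : ∑ i, e i * fderiv ℝ f (r • x) (EuclideanSpace.single i 1) = 0 := hf.2 _ hx
  rw [this, smul_zero]

theorem hasDerivAt_star_mul {m : ℕ} {u v : ℝ → Cl m} {u' v' : Cl m} {t : ℝ}
    (hu : HasDerivAt u u' t) (hv : HasDerivAt v v' t) :
    HasDerivAt (fun t => star (u t) * v t) (star u' * v t + star (u t) * v') t := by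
  have h1 := (starL m).hasFDerivAt.comp_hasDerivAt t hu
  refine ((mulB m).hasFDerivAt_of_bilinear h1.hasFDerivAt hv.hasFDerivAt).hasDerivAt.congr_deriv ?_
  simp [add_comm]

/-- The inner product of the dilates `f(r ·)` and `f(s ·)` over the sphere depends only on the
product `rs`; this is the integrated form of the symmetry of the Euler operator. -/
theorem integral_dilate_mul_dilate {m : ℕ} {f : E m → Cl m} {R : ℝ} (hR : 1 < R)
    (hf : IsLeftMonogenicOn f (Metric.ball 0 R)) {r : ℝ} (h0 : 0 < r) (h1 : r < 1) :
    ∫ η : Sph m, star (f (r • (η : E m))) * f (r • (η : E m)) ∂(surf m)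
      = ∫ η : Sph m, star (f ((r ^ 2) • (η : E m))) * f η ∂(surf m) := by
  -- the product of the dilation factors is constant along `t ↦ (r t, r / t)`, which joins `(r, r)`
  -- at `t = 1` to `(r², 1)` at `t = r` and stays admissible for `t` in the interval `S`
  set S : Set ℝ := Set.Ioi 0 ∩ {t | r * t < R} ∩ {t | r < R * t} with hS
  have hSo : IsOpen S := (isOpen_Ioi.inter (isOpen_lt (by fun_prop) (by fun_prop))).inter
    (isOpen_lt (by fun_prop) (by fun_prop))
  have hSc : Convex ℝ S := by
    refine ((convex_Ioi 0).inter ?_).inter ?_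
    · exact convex_halfSpace_lt (LinearMap.mulLeft ℝ r).isLinear R
    · exact convex_halfSpace_gt (LinearMap.mulLeft ℝ R).isLinear r
  have hm1 : ∀ t ∈ S, ∀ η : Sph m, (r * t) • (η : E m) ∈ Metric.ball (0 : E m) R := by
    rintro t ⟨⟨ht0, ht1⟩, -⟩ η
    simpa [norm_smul, abs_of_pos h0, abs_of_pos (Set.mem_Ioi.1 ht0)] using ht1
  have hm2 : ∀ t ∈ S, ∀ η : Sph m, (r * t⁻¹) • (η : E m) ∈ Metric.ball (0 : E m) R := by
    rintro t ⟨⟨ht0, -⟩, ht2⟩ η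
    have ht0' : 0 < t := ht0
    simpa [norm_smul, abs_of_pos h0, abs_of_pos ht0', ← div_eq_mul_inv, div_lt_iff₀ ht0'] using ht2
  have hne : ∀ t ∈ S, t ≠ 0 := fun t ht => ht.1.1.ne'
  have hfd : ∀ x ∈ Metric.ball (0 : E m) R, HasFDerivAt f (fderiv ℝ f x) x := fun x hx =>
    (hf.differentiableAt Metric.isOpen_ball hx).hasFDerivAt
  have hc1 : ContinuousOn (fun p : ℝ × Sph m => (r * p.1) • (p.2 : E m)) (S ×ˢ Set.univ) := by
    fun_prop
  have hc2 : ContinuousOn (fun p : ℝ × Sph m => (r * p.1⁻¹) • (p.2 : E m)) (S ×ˢ Set.univ) :=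
    (continuousOn_const.mul (continuousOn_fst.inv₀ fun p hp => hne _ hp.1)).smul (by fun_prop)
  have hf1 := hf.1.continuousOn.comp hc1 fun p hp => hm1 _ hp.1 p.2
  have hf2 := hf.1.continuousOn.comp hc2 fun p hp => hm2 _ hp.1 p.2
  have hF := hf.1.continuousOn_fderiv_of_isOpen Metric.isOpen_ball le_rfl
  have hF1 := hF.comp hc1 fun p hp => hm1 _ hp.1 p.2
  have hF2 := hF.comp hc2 fun p hp => hm2 _ hp.1 p.2
  set F : ℝ → Sph m → Cl m := fun t η =>
    star (f ((r * t) • (η : E m))) * f ((r * t⁻¹) • (η : E m)) with hFdef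
  set F' : ℝ → Sph m → Cl m := fun t η => t⁻¹ •
    (star (fderiv ℝ f ((r * t) • (η : E m)) ((r * t) • (η : E m))) * f ((r * t⁻¹) • (η : E m))
    - star (f ((r * t) • (η : E m))) *
      fderiv ℝ f ((r * t⁻¹) • (η : E m)) ((r * t⁻¹) • (η : E m))) with hF'def
  have hder : ∀ t ∈ S, ∀ η, HasDerivAt (fun t => F t η) (F' t η) t := by
    intro t ht η
    have d1 : HasDerivAt (fun t : ℝ => (r * t) • (η : E m)) ((r * 1) • (η : E m)) t :=
      ((hasDerivAt_id t).const_mul r).smul_const _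
    have d2 : HasDerivAt (fun t : ℝ => (r * t⁻¹) • (η : E m)) ((r * -(t ^ 2)⁻¹) • (η : E m)) t :=
      ((hasDerivAt_inv (hne t ht)).const_mul r).smul_const _
    have e3 := hasDerivAt_star_mul ((hfd _ (hm1 t ht η)).comp_hasDerivAt t d1)
      ((hfd _ (hm2 t ht η)).comp_hasDerivAt t d2)
    have hrt : (r * t) • (η : E m) = t • (r * 1) • (η : E m) := by
      rw [smul_smul]; congr 1; ring
    have hrt' : (r * t⁻¹) • (η : E m) = -(t • (r * -(t ^ 2)⁻¹) • (η : E m)) := by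
      rw [smul_smul, ← neg_smul]; congr 1; have := hne t ht; field_simp
    have q1 : fderiv ℝ f ((r * t) • (η : E m)) ((r * t) • (η : E m))
        = t • fderiv ℝ f ((r * t) • (η : E m)) ((r * 1) • (η : E m)) := by
      rw [← map_smul, ← hrt]
    have q2 : fderiv ℝ f ((r * t⁻¹) • (η : E m)) ((r * t⁻¹) • (η : E m))
        = -(t • fderiv ℝ f ((r * t⁻¹) • (η : E m)) ((r * -(t ^ 2)⁻¹) • (η : E m))) := by
      rw [← map_smul, ← map_neg, ← hrt']
    refine e3.congr_deriv ?_
    simp only [hF'def]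
    rw [q1, q2, CliffordAlgebra.star_smul, smul_mul_assoc, mul_neg (star _), mul_smul_comm,
      sub_neg_eq_add, ← smul_add, smul_smul, inv_mul_cancel₀ (hne t ht), one_smul]
    rfl
  have hPd : ∀ t ∈ S, HasDerivAt (fun t => ∫ η, F t η ∂(surf m)) 0 t := by
    intro t ht
    have hint : ∫ η, F' t η ∂(surf m) = 0 := by
      simp only [hF'def]
      rw [integral_smul]
      have h := integral_euler_sub_eq_zero (f := fun x => f ((r * t) • x))
        (g := fun x => f ((r * t⁻¹) • x))
        (V := (fun x => (r * t) • x) ⁻¹' Metric.ball 0 R ∩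
          (fun x => (r * t⁻¹) • x) ⁻¹' Metric.ball 0 R)
        ((Metric.isOpen_ball.preimage (by fun_prop)).inter
          (Metric.isOpen_ball.preimage (by fun_prop)))
        (fun x hx => ⟨hm1 t ht ⟨x, hx⟩, hm2 t ht ⟨x, hx⟩⟩)
        ((hf.comp_smul _).mono Set.inter_subset_left)
        ((hf.comp_smul _).mono Set.inter_subset_right)
      simp only [fderiv_comp_smul, smul_apply, ← map_smul] at h
      rw [h, smul_zero]
    rw [← hint]
    refine hasDerivAt_integral_of_compactSpace (surf m) hSo ?_ ?_ hder ht
    · exact (continuous_star.comp_continuousOn hf1).mul hf2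
    · exact (continuousOn_fst.inv₀ fun p hp => hne _ hp.1).smul
        (((continuous_star.comp_continuousOn (hF1.clm_apply hc1)).mul hf2).sub
          ((continuous_star.comp_continuousOn hf1).mul (hF2.clm_apply hc2)))
  have h1S : (1 : ℝ) ∈ S := ⟨⟨by simp, by simp; linarith⟩, by simp; linarith⟩
  have hrS : r ∈ S := ⟨⟨h0, by simp; nlinarith⟩, by simp; nlinarith⟩
  have := hSo.is_const_of_deriv_eq_zero hSc.isPreconnected
    (fun t ht => (hPd t ht).differentiableAt.differentiableWithinAt)
    (fun t ht => (hPd t ht).deriv) h1S hrS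
  simpa [hFdef, h0.ne', sq] using this

/-! ### The Hardy norm of functions monogenic across the sphere -/

/-- `f` is left monogenic on an open ball that contains the closed unit ball. -/
def IsMonogenicNearBall {m : ℕ} (f : E m → Cl m) : Prop :=
  ∃ R : ℝ, 1 < R ∧ IsLeftMonogenicOn f (Metric.ball 0 R)

namespace IsMonogenicNearBall

variable {m : ℕ} {f g : E m → Cl m}

theorem mul_const (hf : IsMonogenicNearBall f) (c : Cl m) :
    IsMonogenicNearBall fun x => f x * c := by
  obtain ⟨R, hR, h⟩ := hf
  exact ⟨R, hR, h.mul_const Metric.isOpen_ball c⟩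

theorem add (hf : IsMonogenicNearBall f) (hg : IsMonogenicNearBall g) :
    IsMonogenicNearBall fun x => f x + g x := by
  obtain ⟨R, hR, h⟩ := hf
  obtain ⟨R', hR', h'⟩ := hg
  refine ⟨min R R', lt_min hR hR', ?_⟩
  have := IsLeftMonogenicOn.sum (s := Finset.univ) (f := fun b : Bool => cond b f g)
    (U := Metric.ball 0 (min R R')) Metric.isOpen_ball ?_
  · simpa using this
  · rintro (_ | _) -
    · exact h'.mono (Metric.ball_subset_ball (min_le_right _ _))
    · exact h.mono (Metric.ball_subset_ball (min_le_left _ _))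

theorem sum {ι : Type*} {s : Finset ι} {F : ι → E m → Cl m}
    (hF : ∀ i ∈ s, IsMonogenicNearBall (F i)) :
    IsMonogenicNearBall fun x => ∑ i ∈ s, F i x := by
  classical
  induction s using Finset.induction_on with
  | empty =>
    refine ⟨2, by norm_num, ?_⟩
    simpa using IsLeftMonogenicOn.sum (s := (∅ : Finset ι)) (f := F)
      (U := Metric.ball 0 2) Metric.isOpen_ball (by simp)
  | insert i s hi ih =>
    simp only [Finset.sum_insert hi]
    exact (hF i (by simp)).add (ih fun j hj => hF j (by simp [hj]))

theorem continuousOn (hf : IsMonogenicNearBall f) :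
    ContinuousOn f (Metric.closedBall 0 1) := by
  obtain ⟨R, hR, h⟩ := hf
  exact h.1.continuousOn.mono (Metric.closedBall_subset_ball hR)

theorem continuous_dilate (hf : IsMonogenicNearBall f) {r : ℝ} (h0 : 0 ≤ r) (h1 : r ≤ 1) :
    Continuous fun η : Sph m => f (r • (η : E m)) :=
  hf.continuousOn.comp_continuous (by fun_prop) fun η => by
    simpa [norm_smul, abs_of_nonneg h0] using h1

theorem continuous_sphere (hf : IsMonogenicNearBall f) : Continuous fun η : Sph m => f η := by
  simpa using hf.continuous_dilate zero_le_one le_rfl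

end IsMonogenicNearBall

theorem integrable_sphere {m : ℕ} {G : Type*} [NormedAddCommGroup G] [NormedSpace ℝ G]
    {h : Sph m → G} (hh : Continuous h) : Integrable h (surf m) :=
  hh.integrable_of_hasCompactSupport (HasCompactSupport.of_compactSpace _)

theorem continuous_star_mul {m : ℕ} {X : Type*} [TopologicalSpace X] {u v : X → Cl m}
    (hu : Continuous u) (hv : Continuous v) : Continuous fun x => star (u x) * v x :=
  hu.star.mul hv

theorem area_pos (m : ℕ) : 0 < area m := by
  unfold area
  have : 0 < Real.Gamma (((m : ℝ) + 1) / 2) := Real.Gamma_pos_of_pos (by positivity)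
  positivity

/-- The integral `∫ |f(rη)|² dS`. -/
noncomputable def sqInt {m : ℕ} (f : E m → Cl m) (r : ℝ) : ℝ :=
  ∫ η : Sph m, ‖f (r • (η : E m))‖ ^ 2 ∂(surf m)

theorem sqInt_nonneg {m : ℕ} (f : E m → Cl m) (r : ℝ) : 0 ≤ sqInt f r :=
  integral_nonneg fun _ => by positivity

theorem ip_le {m : ℕ} (x y : Cl m) : ip m x y ≤ (1 / 2) * (‖x‖ ^ 2 + ‖y‖ ^ 2) := by
  have h := ip_self (x - y)
  have hs : ip m y x = ip m x y := by simp [ip_apply, mul_comm]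
  rw [map_sub, map_sub, LinearMap.sub_apply, LinearMap.sub_apply, ip_self, ip_self, hs] at h
  nlinarith [sq_nonneg ‖x - y‖]

namespace IsMonogenicNearBall

variable {m : ℕ} {f : E m → Cl m}

/-- Dilation symmetry and the inequality of arithmetic and geometric means give
`2 M(r) ≤ M(r²) + M(1)` for the square integrals `M`. -/
theorem sqInt_le_half (hf : IsMonogenicNearBall f) {r : ℝ} (h0 : 0 < r) (h1 : r < 1) :
    sqInt f r ≤ (1 / 2) * (sqInt f (r ^ 2) + sqInt f 1) := by
  have hr : r ^ 2 ≤ 1 := by nlinarith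
  have c1 := hf.continuous_dilate h0.le h1.le
  have c2 := hf.continuous_dilate (sq_nonneg r) hr
  have c3 := hf.continuous_sphere
  have e1 : sqInt f r = ∫ η : Sph m, ip m (f ((r ^ 2) • (η : E m))) (f η) ∂(surf m) := by
    obtain ⟨R, hR, h⟩ := hf
    have key := congrArg (ScL m) (integral_dilate_mul_dilate hR h h0 h1)
    rw [← (ScL m).integral_comp_comm (integrable_sphere (continuous_star_mul c1 c1)),
      ← (ScL m).integral_comp_comm (integrable_sphere (continuous_star_mul c2 c3))] at key
    simpa only [sqInt, ScL_apply, Sc_star_mul, ip_self] using key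
  have hip : Continuous fun η : Sph m => ip m (f ((r ^ 2) • (η : E m))) (f η) := by
    simp only [← Sc_star_mul, ← ScL_apply]
    exact (ScL m).continuous.comp (continuous_star_mul c2 c3)
  have n2 : Continuous fun η : Sph m => ‖f ((r ^ 2) • (η : E m))‖ ^ 2 := c2.norm.pow 2
  have n3 : Continuous fun η : Sph m => ‖f ((1 : ℝ) • (η : E m))‖ ^ 2 := by
    simp only [one_smul]
    exact c3.norm.pow 2
  rw [e1, sqInt, sqInt, ← integral_add (integrable_sphere n2) (integrable_sphere n3),
    ← integral_const_mul]
  refine integral_mono (integrable_sphere hip)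
    (integrable_sphere (continuous_const.mul (n2.add n3))) fun η => ?_
  simpa using ip_le (f ((r ^ 2) • (η : E m))) (f η)

theorem exists_bound (hf : IsMonogenicNearBall f) :
    ∃ C, ∀ r ∈ Set.Icc (0 : ℝ) 1, ∀ η : Sph m, ‖f (r • (η : E m))‖ ^ 2 ≤ C := by
  obtain ⟨C, hC⟩ := (isCompact_closedBall (0 : E m) 1).exists_bound_of_continuousOn hf.continuousOn
  refine ⟨C ^ 2, fun r hr η => ?_⟩
  have := hC (r • (η : E m)) (by simpa [norm_smul, abs_of_nonneg hr.1] using hr.2)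
  gcongr

/-- The square integrals of a monogenic function over concentric spheres are bounded by the one
over the unit sphere: iterate `2 (M(r) - M(1)) ≤ M(r²) - M(1)`, with `M` bounded. -/
theorem sqInt_le_one (hf : IsMonogenicNearBall f) {r : ℝ} (h0 : 0 < r) (h1 : r < 1) :
    sqInt f r ≤ sqInt f 1 := by
  obtain ⟨C, hC⟩ := hf.exists_bound
  set K := ∫ _ : Sph m, C ∂(surf m)
  have hK : ∀ s, 0 < s → s < 1 → sqInt f s ≤ K := fun s hs0 hs1 =>
    integral_mono (integrable_sphere ((hf.continuous_dilate hs0.le hs1.le).norm.pow 2))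
      (integrable_const C) (hC s ⟨hs0.le, hs1.le⟩)
  have iter : ∀ k : ℕ, ∀ s, 0 < s → s < 1 → sqInt f s - sqInt f 1 ≤ (1 / 2) ^ k * (K - sqInt f 1) := by
    intro k
    induction k with
    | zero => intro s hs0 hs1; simpa using hK s hs0 hs1
    | succ k ih =>
      intro s hs0 hs1
      have h2 := hf.sqInt_le_half hs0 hs1
      have h3 := ih (s ^ 2) (by positivity) (by nlinarith)
      rw [pow_succ]
      linarith
  have hlim : Tendsto (fun k : ℕ => (1 / 2 : ℝ) ^ k * (K - sqInt f 1)) atTop (𝓝 0) := by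
    simpa using (tendsto_pow_atTop_nhds_zero_of_lt_one (r := (1 / 2 : ℝ)) (by norm_num)
      (by norm_num)).mul_const (K - sqInt f 1)
  have := ge_of_tendsto' hlim fun k => iter k r h0 h1
  linarith

theorem tendsto_sqInt (hf : IsMonogenicNearBall f) :
    Tendsto (sqInt f) (𝓝[Set.Ioo 0 1] 1) (𝓝 (sqInt f 1)) := by
  obtain ⟨C, hC⟩ := hf.exists_bound
  refine tendsto_integral_filter_of_dominated_convergence (fun _ => C) ?_ ?_
    (integrable_const C) ?_
  · filter_upwards [self_mem_nhdsWithin] with r hr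
    exact ((hf.continuous_dilate hr.1.le hr.2.le).norm.pow 2).aestronglyMeasurable
  · filter_upwards [self_mem_nhdsWithin] with r hr
    refine Eventually.of_forall fun η => ?_
    rw [Real.norm_of_nonneg (by positivity)]
    exact hC r ⟨hr.1.le, hr.2.le⟩ η
  · refine Eventually.of_forall fun η => ?_
    obtain ⟨R, hR, h⟩ := hf
    have hη : (1 : ℝ) • (η : E m) ∈ Metric.ball (0 : E m) R := by simpa using hR
    have hc : ContinuousAt f ((1 : ℝ) • (η : E m)) :=
      (h.differentiableAt Metric.isOpen_ball hη).continuousAt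
    have hs : ContinuousAt (fun r : ℝ => r • (η : E m)) 1 := by fun_prop
    exact ((hc.comp (f := fun r : ℝ => r • (η : E m)) hs).norm.pow 2).tendsto.mono_left
      nhdsWithin_le_nhds

/-- The supremum defining the Hardy norm is attained in the limit at the unit sphere. -/
theorem hardyENorm_eq (hf : IsMonogenicNearBall f) :
    hardyENorm f = ENNReal.ofReal (√((area m)⁻¹ * sqInt f 1)) := by
  have hm : ∀ r ∈ Set.Ioo (0 : ℝ) 1, (ENNReal.ofReal (area m)⁻¹ *
      ∫⁻ η : Sph m, ‖f (r • (η : E m))‖ₑ ^ 2 ∂(surf m)) ^ ((1 : ℝ) / 2)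
      = ENNReal.ofReal (√((area m)⁻¹ * sqInt f r)) := by
    intro r hr
    have hi : Integrable (fun η : Sph m => ‖f (r • (η : E m))‖ ^ 2) (surf m) :=
      integrable_sphere ((hf.continuous_dilate hr.1.le hr.2.le).norm.pow 2)
    have : ∫⁻ η : Sph m, ‖f (r • (η : E m))‖ₑ ^ 2 ∂(surf m) = ENNReal.ofReal (sqInt f r) := by
      rw [sqInt, ofReal_integral_eq_lintegral_ofReal hi
        (Eventually.of_forall fun _ => by positivity)]
      refine lintegral_congr fun η => ?_
      rw [ENNReal.ofReal_pow (norm_nonneg _), ofReal_norm]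
    rw [this, ← ENNReal.ofReal_mul (inv_nonneg.2 (area_pos m).le),
      ENNReal.ofReal_rpow_of_nonneg (mul_nonneg (inv_nonneg.2 (area_pos m).le) (sqInt_nonneg f r))
        (by norm_num), Real.sqrt_eq_rpow]
  rw [hardyENorm]
  refine le_antisymm (iSup₂_le fun r hr => ?_) ?_
  · rw [hm r hr]
    have := hf.sqInt_le_one hr.1 hr.2
    have := (area_pos m).le
    gcongr
  · have hne : (𝓝[Set.Ioo (0 : ℝ) 1] 1).NeBot := by
      rw [nhdsWithin_Ioo_eq_nhdsLT zero_lt_one]; infer_instance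
    have ht : Tendsto (fun r => ENNReal.ofReal (√((area m)⁻¹ * sqInt f r))) (𝓝[Set.Ioo 0 1] 1)
        (𝓝 (ENNReal.ofReal (√((area m)⁻¹ * sqInt f 1)))) :=
      ENNReal.tendsto_ofReal ((hf.tendsto_sqInt.const_mul _).sqrt)
    refine le_of_tendsto ht ?_
    filter_upwards [self_mem_nhdsWithin] with r hr
    rw [← hm r hr]
    exact le_iSup₂ (f := fun r (_ : r ∈ Set.Ioo (0 : ℝ) 1) => (ENNReal.ofReal (area m)⁻¹ *
      ∫⁻ η : Sph m, ‖f (r • (η : E m))‖ₑ ^ 2 ∂(surf m)) ^ ((1 : ℝ) / 2)) r hr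

theorem memHardy (hf : IsMonogenicNearBall f) : MemHardy f := by
  refine ⟨?_, by rw [hf.hardyENorm_eq]; exact ENNReal.ofReal_lt_top⟩
  obtain ⟨R, hR, h⟩ := hf
  exact h.mono (Metric.ball_subset_ball hR.le)

theorem hardyNorm_eq (hf : IsMonogenicNearBall f) :
    hardyNorm f = √((area m)⁻¹ * sqInt f 1) := by
  rw [hardyNorm, hf.hardyENorm_eq, ENNReal.toReal_ofReal (Real.sqrt_nonneg _)]

end IsMonogenicNearBall

/-! ### Boundary values -/

theorem approach_neBot {m : ℕ} (η : Sph m) : (𝓝[approach 2 η] (η : E m)).NeBot := by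
  have hne : (𝓝[<] (1 : ℝ)).NeBot := inferInstance
  -- the radius ending at `η` stays in the approach region
  have ht : Tendsto (fun r : ℝ => r • (η : E m)) (𝓝[<] 1) (𝓝[approach 2 η] (η : E m)) := by
    refine tendsto_nhdsWithin_iff.2 ⟨?_, ?_⟩
    · have : ContinuousAt (fun r : ℝ => r • (η : E m)) 1 := by fun_prop
      simpa using this.tendsto.mono_left nhdsWithin_le_nhds
    · filter_upwards [Ioo_mem_nhdsLT (zero_lt_one (α := ℝ))] with r hr
      have h1 : ‖r • (η : E m)‖ = r := by simp [norm_smul, abs_of_pos hr.1]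
      have h2 : ‖r • (η : E m) - η‖ = 1 - r := by
        have : r • (η : E m) - η = (r - 1) • (η : E m) := by module
        rw [this, norm_smul, Real.norm_eq_abs, abs_sub_comm, abs_of_pos (by linarith [hr.2])]
        simp
      refine ⟨by rw [h1]; exact hr.2, ?_⟩
      rw [h1, h2]
      linarith [hr.2]
  exact ht.neBot

namespace IsMonogenicNearBall

variable {m : ℕ} {f : E m → Cl m}

theorem hasNTLimit (hf : IsMonogenicNearBall f) (η : Sph m) : HasNTLimit f η (f η) := by
  obtain ⟨R, hR, h⟩ := hf
  intro α _
  have hη : (η : E m) ∈ Metric.ball (0 : E m) R := by simpa using hR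
  exact (h.differentiableAt Metric.isOpen_ball hη).continuousAt.tendsto.mono_left
    nhdsWithin_le_nhds

theorem bdry_eq (hf : IsMonogenicNearBall f) : bdry f = fun η : Sph m => f η := by
  funext η
  have h : ∃ L, HasNTLimit f η L := ⟨_, hf.hasNTLimit η⟩
  have := approach_neBot η
  rw [bdry, dif_pos h]
  exact tendsto_nhds_unique (h.choose_spec 2 one_lt_two) (hf.hasNTLimit η 2 one_lt_two)

theorem hasL2Boundary (hf : IsMonogenicNearBall f) : HasL2Boundary f := by
  rw [HasL2Boundary, hf.bdry_eq]
  exact ⟨Eventually.of_forall hf.hasNTLimit, hf.continuous_sphere.memLp_of_hasCompactSupport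
    (HasCompactSupport.of_compactSpace _)⟩

end IsMonogenicNearBall

/-! ### Linear independence of Szegő kernels -/

theorem isMonogenicNearBall_szego {m : ℕ} {a : E m} (ha : ‖a‖ < 1) :
    IsMonogenicNearBall (szego a) := by
  obtain ⟨R, hR1, hR⟩ : ∃ R : ℝ, 1 < R ∧ ‖a‖ * R < 1 := by
    refine ⟨2 / (1 + ‖a‖), ?_, ?_⟩
    · rw [lt_div_iff₀ (by positivity)]; linarith
    · rw [← mul_div_assoc, div_lt_one (by positivity)]; linarith
  have hne : ∀ x ∈ Metric.ball (0 : E m) R, szegoDen a x ≠ 0 := fun x hx => by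
    have hx : ‖x‖ < R := by simpa using hx
    exact (szegoDen_pos (lt_of_le_of_lt (by gcongr) hR)).ne'
  exact ⟨R, hR1, fun x hx => (contDiffAt_szego (hne x hx)).contDiffWithinAt,
    fun x hx => dirac_szego (hne x hx)⟩

/-- A function monogenic across the sphere whose square integral over the sphere is zero vanishes in
the punctured closed ball (and then at the centre, by continuity). -/
theorem IsMonogenicNearBall.eq_zero_of_sqInt_eq_zero {m : ℕ} {f : E m → Cl m}
    (hf : IsMonogenicNearBall f) (h : sqInt f 1 = 0) {x : E m} (hx0 : x ≠ 0) (hx1 : ‖x‖ ≤ 1) :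
    f x = 0 := by
  have hpos : 0 < ‖x‖ := norm_pos_iff.2 hx0
  have hr : sqInt f ‖x‖ = 0 := by
    rcases hx1.lt_or_eq with h1 | h1
    · exact le_antisymm ((hf.sqInt_le_one hpos h1).trans h.le) (sqInt_nonneg _ _)
    · rw [h1, h]
  have hc : Continuous fun η : Sph m => ‖f (‖x‖ • (η : E m))‖ ^ 2 :=
    (hf.continuous_dilate hpos.le hx1).norm.pow 2
  have h0 := (integral_eq_zero_iff_of_nonneg (fun _ => by positivity)
    (integrable_sphere hc)).1 hr
  have h1 := congrFun ((Continuous.ae_eq_iff_eq (surf m) hc continuous_const).1 h0)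
    ⟨‖x‖⁻¹ • x, by simp [norm_smul, hpos.ne']⟩
  have h2 : ‖f x‖ ^ 2 = 0 := by
    simp only [smul_smul, mul_inv_cancel₀ hpos.ne', one_smul] at h1
    exact h1
  simpa using h2

/-- The absolute value of a Szegő kernel, applied to a Clifford number, in a form that can be
evaluated in the limit at the pole, where `szegoDen a x` tends to `0`. -/
theorem norm_szego_mul_sq {m : ℕ} {a x : E m} (h : szegoDen a x ≠ 0) (d : Cl m) :
    szegoDen a x ^ m * ‖szego a x * d‖ ^ 2 = ‖d‖ ^ 2 := by
  have hQ : 0 < szegoDen a x := lt_of_le_of_ne (szegoDen_nonneg a x) h.symm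
  have h1 : ‖(1 - star (para x) * para a) * d‖ ^ 2 = szegoDen a x * ‖d‖ ^ 2 := by
    rw [← ip_self, ip_mul, ← mul_assoc, ← star_one_sub, star_star, star_one_sub,
      one_sub_mul_star_one_sub, smul_one_mul, map_smul, ip_self, smul_eq_mul]
  rw [szego_eq, smul_mul_assoc, norm_smul, mul_pow, h1, Real.norm_of_nonneg (by positivity),
    ← mul_assoc, ← mul_assoc, ← Real.rpow_natCast, ← Real.rpow_natCast, ← Real.rpow_mul hQ.le,
    ← Real.rpow_add hQ, ← Real.rpow_add_one hQ.ne']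
  have : (m : ℝ) + -((m : ℝ) + 1) / 2 * ((2 : ℕ) : ℝ) + 1 = 0 := by push_cast; ring
  rw [this, Real.rpow_zero, one_mul]

/-- The pole of a Szegő kernel is the inversion of its parameter in the sphere. -/
theorem eq_of_szegoDen_eq_zero {m : ℕ} {a x : E m} (h : szegoDen a x = 0) :
    a ≠ 0 ∧ x = (‖a‖ ^ 2)⁻¹ • a := by
  have ha : a ≠ 0 := by
    rintro rfl
    simp [szegoDen] at h
  have h1 : ‖(1 - star (para a) * para x : Cl m)‖ = 0 := by
    have := norm_one_sub_sq a x
    rw [h] at this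
    exact pow_eq_zero_iff two_ne_zero |>.1 this
  have h2 : (star (para a) * para x : Cl m) = 1 := (sub_eq_zero.1 (norm_eq_zero.1 h1)).symm
  have h3 : (para ((‖a‖ ^ 2) • x - a) : Cl m) = 0 := by
    rw [para_sub, para_smul, ← smul_one_mul, ← para_mul_star_para, mul_assoc, h2, mul_one,
      sub_self]
  have h4 : (‖a‖ ^ 2) • x = a := by
    rw [← sub_eq_zero, ← norm_eq_zero, ← norm_para, h3, norm_zero]
  refine ⟨ha, ?_⟩
  have : ‖a‖ ^ 2 ≠ 0 := by simpa using ha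
  exact (eq_inv_smul_iff₀ this).2 h4

theorem szegoDen_pole {m : ℕ} {a : E m} (ha : a ≠ 0) : szegoDen a ((‖a‖ ^ 2)⁻¹ • a) = 0 := by
  have : ‖a‖ ≠ 0 := norm_ne_zero_iff.2 ha
  rw [szegoDen, inner_smul_right, real_inner_self_eq_norm_sq, norm_smul]
  simp
  field_simp
  ring

theorem pole_injective {m : ℕ} {a b : E m} (ha : a ≠ 0) (hb : b ≠ 0)
    (h : (‖a‖ ^ 2)⁻¹ • a = (‖b‖ ^ 2)⁻¹ • b) : a = b := by
  have ha' : ‖a‖ ≠ 0 := norm_ne_zero_iff.2 ha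
  have hb' : ‖b‖ ≠ 0 := norm_ne_zero_iff.2 hb
  have hn : ‖a‖ = ‖b‖ := by
    have := congrArg norm h
    simp only [norm_smul, norm_inv, norm_pow, norm_norm] at this
    field_simp at this
    exact this.symm
  rw [hn] at h
  exact smul_right_injective _ (inv_ne_zero (pow_ne_zero 2 hb')) h

/-- Right linear independence of Szegő kernels with distinct parameters. A combination that
vanishes on the sphere vanishes in the ball and then, by analytic continuation, off the poles;
near the pole of one kernel the others stay bounded, so its coefficient is zero. -/
theorem szego_linearIndependent {m : ℕ} (hm : 1 ≤ m) {ι : Type*} {s : Finset ι} {a : ι → E m}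
    (ha : ∀ i ∈ s, ‖a i‖ < 1) (hinj : Set.InjOn a s) {d : ι → Cl m}
    (h : sqInt (fun x => ∑ i ∈ s, szego (a i) x * d i) 1 = 0) : ∀ i ∈ s, d i = 0 := by
  classical
  set f : E m → Cl m := fun x => ∑ i ∈ s, szego (a i) x * d i with hf
  have hmono : IsMonogenicNearBall f :=
    .sum fun i hi => (isMonogenicNearBall_szego (ha i hi)).mul_const (d i)
  set P : Set (E m) := {x | ∃ i ∈ s, szegoDen (a i) x = 0} with hP
  have hPc : P.Countable := by
    refine ((s.finite_toSet.image fun i => (‖a i‖ ^ 2)⁻¹ • a i).subset ?_).countable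
    rintro x ⟨i, hi, hx⟩
    exact ⟨i, hi, (eq_of_szegoDen_eq_zero hx).2.symm⟩
  have hne : ∀ {x}, x ∈ Pᶜ → ∀ i ∈ s, szegoDen (a i) x ≠ 0 := fun hx i hi h => hx ⟨i, hi, h⟩
  have hrank : 1 < Module.rank ℝ (E m) := by
    rw [← Module.finrank_eq_rank, finrank_euclideanSpace_fin]
    exact_mod_cast (by omega : 1 < m + 1)
  -- the complement of the finitely many poles is connected because `m + 1 ≥ 2`
  have han : AnalyticOnNhd ℝ f Pᶜ := fun x hx => by
    refine ContDiffAt.analyticAt ?_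
    exact ContDiffAt.sum fun i hi =>
      ((mulB m).flip (d i)).contDiff.contDiffAt.comp x (contDiffAt_szego (hne hx i hi))
  have hball : ∀ x : E m, ‖x‖ < 1 → x ∈ Pᶜ := by
    rintro x hx ⟨i, hi, h0⟩
    have := ha i hi
    exact (szegoDen_pos (by nlinarith [norm_nonneg x, norm_nonneg (a i)])).ne' h0
  have hzero : Set.EqOn f 0 Pᶜ := by
    refine han.eqOn_zero_of_preconnected_of_eventuallyEq_zero
      (hPc.isConnected_compl_of_one_lt_rank hrank).isPreconnected
      (z₀ := EuclideanSpace.single 0 (1 / 2)) (hball _ (by simp; norm_num)) ?_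
    have hz : (EuclideanSpace.single 0 (1 / 2) : E m) ∈ Metric.ball (0 : E m) 1 ∩ {0}ᶜ := by
      constructor
      · simp; norm_num
      · simp
    filter_upwards [(Metric.isOpen_ball.inter isOpen_compl_singleton).mem_nhds hz] with x hx
    exact hmono.eq_zero_of_sqInt_eq_zero h hx.2 (mem_ball_zero_iff.1 hx.1).le
  have hpole : ∀ i ∈ s, a i ≠ 0 → d i = 0 := by
    intro i hi hai
    set p := (‖a i‖ ^ 2)⁻¹ • a i with hp
    set g : E m → Cl m := fun x => ∑ j ∈ s.erase i, szego (a j) x * d j with hg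
    have hgc : ContinuousAt g p := by
      refine tendsto_finsetSum _ fun j hj => ?_
      rw [Finset.mem_erase] at hj
      have hjp : szegoDen (a j) p ≠ 0 := fun h0 => by
        obtain ⟨h1, h2⟩ := eq_of_szegoDen_eq_zero h0
        exact hj.1 (hinj hj.2 hi (pole_injective h1 hai h2.symm))
      exact ((contDiffAt_szego (n := 1) hjp).continuousAt.tendsto).mul_const _
    have hnb : (𝓝[Pᶜ] p).NeBot :=
      mem_closure_iff_nhdsWithin_neBot.1 ((hPc.dense_compl ℝ) p)
    have hlim : Tendsto (fun x => szegoDen (a i) x ^ m * ‖g x‖ ^ 2) (𝓝[Pᶜ] p) (𝓝 0) := by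
      have h1 : ContinuousAt (fun x => szegoDen (a i) x ^ m * ‖g x‖ ^ 2) p :=
        ((contDiff_szegoDen (n := 1) (a i)).continuous.continuousAt.pow m).mul (hgc.norm.pow 2)
      have h2 := h1.tendsto
      rw [szegoDen_pole hai, zero_pow (by omega), zero_mul] at h2
      exact h2.mono_left nhdsWithin_le_nhds
    have hev : ∀ᶠ x in 𝓝[Pᶜ] p, szegoDen (a i) x ^ m * ‖g x‖ ^ 2 = ‖d i‖ ^ 2 := by
      filter_upwards [self_mem_nhdsWithin] with x hx
      have h1 : szego (a i) x * d i = -g x := by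
        have := hzero hx
        rw [eq_neg_iff_add_eq_zero, hg]
        simp only
        rw [Finset.add_sum_erase s (fun j => szego (a j) x * d j) hi]
        exact this
      rw [← norm_szego_mul_sq (hne hx i hi) (d i), h1, norm_neg]
    have := tendsto_nhds_unique (hlim.congr' hev) tendsto_const_nhds
    simpa using this.symm
  intro i hi
  by_cases hai : a i = 0
  · have h0 : (0 : E m) ∈ Pᶜ := hball 0 (by simp)
    have h1 : szego (a i) 0 * d i = 0 := by
      have h2 : f 0 = 0 := hzero h0
      rw [hf] at h2
      simp only at h2
      rwa [Finset.sum_eq_single_of_mem i hi] at h2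
      intro j hj hji
      rw [hpole j hj fun haj => hji (hinj hj hi (haj.trans hai.symm)), mul_zero]
    have := norm_szego_mul_sq (hne h0 i hi) (d i)
    rw [h1] at this
    simpa using this.symm
  · exact hpole i hi hai

/-! ### The Clifford-valued inner product -/

section Inner

variable {m : ℕ} {f g : E m → Cl m}

theorem hardyInner_eq (hf : IsMonogenicNearBall f) (hg : IsMonogenicNearBall g) :
    hardyInner f g = (area m)⁻¹ • ∫ η : Sph m, star (g η) * f η ∂(surf m) := by
  rw [hardyInner, hf.bdry_eq, hg.bdry_eq]

theorem integrable_star_mul (hf : IsMonogenicNearBall f) (hg : IsMonogenicNearBall g) :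
    Integrable (fun η : Sph m => star (g η) * f η) (surf m) :=
  integrable_sphere (continuous_star_mul hg.continuous_sphere hf.continuous_sphere)

theorem star_hardyInner (hf : IsMonogenicNearBall f) (hg : IsMonogenicNearBall g) :
    star (hardyInner f g) = hardyInner g f := by
  rw [hardyInner_eq hf hg, hardyInner_eq hg hf, CliffordAlgebra.star_smul, ← starL_apply,
    ← (starL m).integral_comp_comm (integrable_star_mul hf hg)]
  simp

theorem hardyInner_mul_const (hf : IsMonogenicNearBall f) (hg : IsMonogenicNearBall g)
    (c : Cl m) : hardyInner (fun x => f x * c) g = hardyInner f g * c := by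
  rw [hardyInner_eq (hf.mul_const c) hg, hardyInner_eq hf hg, smul_mul_assoc]
  have := ((mulB m).flip c).integral_comp_comm (integrable_star_mul hf hg)
  simp only [ContinuousLinearMap.flip_apply, mulB_apply] at this
  rw [← this]
  simp only [mul_assoc]

theorem hardyInner_add {f' : E m → Cl m} (hf : IsMonogenicNearBall f)
    (hf' : IsMonogenicNearBall f') (hg : IsMonogenicNearBall g) :
    hardyInner (fun x => f x + f' x) g = hardyInner f g + hardyInner f' g := by
  rw [hardyInner_eq (hf.add hf') hg, hardyInner_eq hf hg, hardyInner_eq hf' hg, ← smul_add,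
    ← integral_add (integrable_star_mul hf hg) (integrable_star_mul hf' hg)]
  simp only [mul_add]

theorem hardyInner_sum {ι : Type*} {s : Finset ι} {F : ι → E m → Cl m}
    (hF : ∀ i ∈ s, IsMonogenicNearBall (F i)) (hg : IsMonogenicNearBall g) :
    hardyInner (fun x => ∑ i ∈ s, F i x) g = ∑ i ∈ s, hardyInner (F i) g := by
  rw [hardyInner_eq (.sum hF) hg, Finset.sum_congr rfl fun i hi => hardyInner_eq (hF i hi) hg,
    ← Finset.smul_sum, ← integral_finsetSum _ fun i hi => integrable_star_mul (hF i hi) hg]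
  simp only [Finset.mul_sum]

/-- The scalar part of `\bar v ⟨f, f⟩ v` is the normalized square integral of `f v`. -/
theorem ip_hardyInner_self_mul (hf : IsMonogenicNearBall f) (v : Cl m) :
    ip m v (hardyInner f f * v) = (area m)⁻¹ * sqInt (fun x => f x * v) 1 := by
  have hfv := hf.mul_const v
  rw [← hardyInner_mul_const hf hf, ← Sc_star_mul]
  have h1 : star v * hardyInner (fun x => f x * v) f
      = hardyInner (fun x => f x * v) (fun x => f x * v) := by
    rw [← star_hardyInner hfv hfv, hardyInner_mul_const hf hfv, star_mul, star_hardyInner hf hfv]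
  rw [h1, hardyInner_eq hfv hfv, ← ScL_apply, map_smul,
    ← (ScL m).integral_comp_comm (integrable_star_mul hfv hfv), sqInt]
  simp only [ScL_apply, Sc_star_mul_self, one_smul, smul_eq_mul]

theorem Sc_hardyInner_self (hf : IsMonogenicNearBall f) :
    Sc (hardyInner f f) = hardyNorm f ^ 2 := by
  have := ip_hardyInner_self_mul hf 1
  simp only [mul_one] at this
  rw [Sc_eq_ip, this, hf.hardyNorm_eq, Real.sq_sqrt
    (mul_nonneg (inv_nonneg.2 (area_pos m).le) (sqInt_nonneg _ _))]

end Inner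

/-! ### The Gram–Schmidt process -/

theorem gsT_apply {m : ℕ} (a : ℕ → E m) (n : ℕ) (x : E m) :
    gsT a n x = szego (a n) x + ∑ i : Fin n, gsT a i x *
      -(Ring.inverse (hardyInner (gsT a i) (gsT a i)) * hardyInner (szego (a n)) (gsT a i)) := by
  rw [gsT]
  simp [sub_eq_add_neg]

/-- `T_n` is the Szegő kernel at `a_n` plus a combination of the preceding ones. -/
theorem exists_gsT_eq_sum {m : ℕ} (a : ℕ → E m) (n : ℕ) :
    ∃ c : ℕ → Cl m, c n = 1 ∧ (∀ k, n < k → c k = 0) ∧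
      ∀ x, gsT a n x = ∑ k ∈ Finset.range (n + 1), szego (a k) x * c k := by
  induction n using Nat.strong_induction_on with
  | _ n ih =>
    choose! c hc1 hc0 hc using ih
    set b : Fin n → Cl m := fun i =>
      -(Ring.inverse (hardyInner (gsT a i) (gsT a i)) * hardyInner (szego (a n)) (gsT a i)) with hb
    refine ⟨fun k => if k = n then 1 else if k < n then ∑ i : Fin n, c i k * b i else 0,
      by simp, fun k hk => by simp [hk.ne', hk.le.not_gt], fun x => ?_⟩
    have hext : ∀ i : Fin n, gsT a i x = ∑ k ∈ Finset.range n, szego (a k) x * c i k := by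
      intro i
      rw [hc i i.2 x]
      refine Finset.sum_subset (Finset.range_subset_range.2 i.2) fun k _ hk => ?_
      rw [hc0 i i.2 k (by simpa using hk), mul_zero]
    rw [gsT_apply, Finset.sum_range_succ, add_comm]
    congr 1
    · simp only [hext, Finset.sum_mul]
      rw [Finset.sum_comm]
      refine Finset.sum_congr rfl fun k hk => ?_
      have hk : k < n := Finset.mem_range.1 hk
      rw [if_neg hk.ne, if_pos hk, Finset.mul_sum]
      simp only [mul_assoc, hb]
    · simp

section GramSchmidt

variable {m : ℕ} {a : ℕ → E m}

theorem isMonogenicNearBall_gsT (ha : ∀ n, ‖a n‖ < 1) (n : ℕ) :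
    IsMonogenicNearBall (gsT a n) := by
  obtain ⟨c, -, -, hc⟩ := exists_gsT_eq_sum a n
  rw [funext hc]
  exact .sum fun k _ => (isMonogenicNearBall_szego (ha k)).mul_const (c k)

theorem eq_zero_of_sqInt_gsT_mul (hm : 1 ≤ m) (ha : ∀ n, ‖a n‖ < 1)
    (hinj : Function.Injective a) {n : ℕ} {v : Cl m} (h : sqInt (fun x => gsT a n x * v) 1 = 0) :
    v = 0 := by
  obtain ⟨c, hc1, -, hc⟩ := exists_gsT_eq_sum a n
  simp only [hc, Finset.sum_mul, mul_assoc] at h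
  have := szego_linearIndependent hm (fun k _ => ha k) hinj.injOn h n (by simp)
  rwa [hc1, one_mul] at this

theorem isUnit_hardyInner_gsT (hm : 1 ≤ m) (ha : ∀ n, ‖a n‖ < 1) (hinj : Function.Injective a)
    (n : ℕ) : IsUnit (hardyInner (gsT a n) (gsT a n)) := by
  refine isUnit_of_mul_injective fun v hv => eq_zero_of_sqInt_gsT_mul hm ha hinj (n := n) ?_
  have := ip_hardyInner_self_mul (isMonogenicNearBall_gsT ha n) v
  rw [hv, map_zero] at this
  exact (mul_eq_zero.1 this.symm).resolve_left
    (inv_ne_zero (area_pos m).ne')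

theorem hardyNorm_gsT_pos (hm : 1 ≤ m) (ha : ∀ n, ‖a n‖ < 1) (hinj : Function.Injective a)
    (n : ℕ) : 0 < hardyNorm (gsT a n) := by
  rw [(isMonogenicNearBall_gsT ha n).hardyNorm_eq]
  have hpos := area_pos m
  refine Real.sqrt_pos.2 (mul_pos (inv_pos.2 hpos) (lt_of_le_of_ne (sqInt_nonneg _ _) ?_))
  intro h
  have h1 : (1 : Cl m) = 0 :=
    eq_zero_of_sqInt_gsT_mul hm ha hinj (n := n) (by simpa using h.symm)
  have h2 := norm_one_Cl m
  rw [h1, norm_zero] at h2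
  exact zero_ne_one h2

theorem hardyInner_gsT_of_lt (hm : 1 ≤ m) (ha : ∀ n, ‖a n‖ < 1) (hinj : Function.Injective a)
    (n : ℕ) : ∀ j < n, hardyInner (gsT a n) (gsT a j) = 0 := by
  induction n using Nat.strong_induction_on with
  | _ n ih =>
    intro j hj
    have hT := isMonogenicNearBall_gsT ha
    have hS := isMonogenicNearBall_szego (ha n)
    have hM : ∀ i : Fin n, IsMonogenicNearBall fun x => gsT a i x *
        -(Ring.inverse (hardyInner (gsT a i) (gsT a i)) * hardyInner (szego (a n)) (gsT a i)) :=
      fun i => (hT i).mul_const _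
    rw [funext (gsT_apply a n), hardyInner_add hS (.sum fun i _ => hM i) (hT j),
      hardyInner_sum (fun i _ => hM i) (hT j)]
    simp only [hardyInner_mul_const (hT _) (hT j)]
    rw [Finset.sum_eq_single_of_mem (⟨j, hj⟩ : Fin n) (Finset.mem_univ _)]
    · rw [mul_neg, ← mul_assoc,
        Ring.mul_inverse_cancel _ (isUnit_hardyInner_gsT hm ha hinj j), one_mul, add_neg_cancel]
    · intro i _ hij
      rcases lt_or_gt_of_ne (fun h : (i : ℕ) = j => hij (Fin.ext h)) with h | h
      · rw [← star_hardyInner (hT j) (hT i), ih j hj i h, star_zero, zero_mul]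
      · rw [ih i i.2 j h, zero_mul]

theorem hardyInner_gsT_of_ne (hm : 1 ≤ m) (ha : ∀ n, ‖a n‖ < 1) (hinj : Function.Injective a)
    {i j : ℕ} (hij : i ≠ j) : hardyInner (gsT a i) (gsT a j) = 0 := by
  rcases lt_or_gt_of_ne hij with h | h
  · rw [← star_hardyInner (isMonogenicNearBall_gsT ha j) (isMonogenicNearBall_gsT ha i),
      hardyInner_gsT_of_lt hm ha hinj j i h, star_zero]
  · exact hardyInner_gsT_of_lt hm ha hinj i j h

theorem tmB_eq (a : ℕ → E m) (n : ℕ) :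
    tmB a n = fun x => gsT a n x * algebraMap ℝ (Cl m) (hardyNorm (gsT a n))⁻¹ := by
  funext x
  rw [tmB, ← Algebra.commutes, Algebra.smul_def]

theorem isMonogenicNearBall_tmB (ha : ∀ n, ‖a n‖ < 1) (n : ℕ) :
    IsMonogenicNearBall (tmB a n) := by
  rw [tmB_eq]
  exact (isMonogenicNearBall_gsT ha n).mul_const _

theorem hardyInner_tmB_of_ne (hm : 1 ≤ m) (ha : ∀ n, ‖a n‖ < 1) (hinj : Function.Injective a)
    {i j : ℕ} (hij : i ≠ j) : hardyInner (tmB a i) (tmB a j) = 0 := by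
  have hi := isMonogenicNearBall_gsT ha i
  have hj := isMonogenicNearBall_gsT ha j
  have h1 : hardyInner (tmB a j) (gsT a i) = 0 := by
    rw [tmB_eq, hardyInner_mul_const hj hi, hardyInner_gsT_of_ne hm ha hinj hij.symm, zero_mul]
  have hB := isMonogenicNearBall_tmB ha j
  rw [tmB_eq a i, hardyInner_mul_const hi hB, ← star_hardyInner hB hi, h1, star_zero, zero_mul]

theorem hardyNorm_tmB (hm : 1 ≤ m) (ha : ∀ n, ‖a n‖ < 1) (hinj : Function.Injective a) (n : ℕ) :
    hardyNorm (tmB a n) = 1 := by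
  have hT := isMonogenicNearBall_gsT ha n
  have hpos := hardyNorm_gsT_pos hm ha hinj n
  have h1 : sqInt (tmB a n) 1 = (hardyNorm (gsT a n))⁻¹ ^ 2 * sqInt (gsT a n) 1 := by
    simp only [sqInt, tmB, norm_smul, mul_pow, Real.norm_eq_abs, sq_abs]
    rw [integral_const_mul]
  rw [(isMonogenicNearBall_tmB ha n).hardyNorm_eq, h1, mul_left_comm, Real.sqrt_mul (by positivity),
    Real.sqrt_sq (by positivity), ← hT.hardyNorm_eq, inv_mul_cancel₀ hpos.ne']

end GramSchmidt

end CliffTM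

theorem theorem4p1 (m : ℕ) (hm : 1 ≤ m) (a : ℕ → CliffTM.E m)
    (ha : ∀ n, a n ∈ Metric.ball (0 : CliffTM.E m) 1) (hinj : Function.Injective a) :
    -- the functions belong to the Hardy space, and their inner products are meaningful
    (∀ n, CliffTM.MemHardy (CliffTM.szego (a n)) ∧ CliffTM.HasL2Boundary (CliffTM.szego (a n))) ∧
    (∀ n, CliffTM.MemHardy (CliffTM.gsT a n) ∧ CliffTM.HasL2Boundary (CliffTM.gsT a n)) ∧
    (∀ n, CliffTM.MemHardy (CliffTM.tmB a n) ∧ CliffTM.HasL2Boundary (CliffTM.tmB a n)) ∧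
    -- every inverse occurring in the recursion exists
    (∀ n, IsUnit (CliffTM.hardyInner (CliffTM.gsT a n) (CliffTM.gsT a n))) ∧
    -- orthogonality, and normalization by a positive number
    (∀ i j, i ≠ j → CliffTM.hardyInner (CliffTM.gsT a i) (CliffTM.gsT a j) = 0) ∧
    (∀ i j, i ≠ j → CliffTM.hardyInner (CliffTM.tmB a i) (CliffTM.tmB a j) = 0) ∧
    (∀ n, 0 < CliffTM.hardyNorm (CliffTM.gsT a n)) ∧
    (∀ n, CliffTM.hardyNorm (CliffTM.tmB a n) = 1 ∧
      CliffTM.Sc (CliffTM.hardyInner (CliffTM.tmB a n) (CliffTM.tmB a n)) = 1) := by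
  have ha' : ∀ n, ‖a n‖ < 1 := fun n => by simpa using ha n
  have hS := fun n => CliffTM.isMonogenicNearBall_szego (ha' n)
  have hT := CliffTM.isMonogenicNearBall_gsT ha'
  have hB := CliffTM.isMonogenicNearBall_tmB ha'
  exact ⟨fun n => ⟨(hS n).memHardy, (hS n).hasL2Boundary⟩,
    fun n => ⟨(hT n).memHardy, (hT n).hasL2Boundary⟩,
    fun n => ⟨(hB n).memHardy, (hB n).hasL2Boundary⟩,
    CliffTM.isUnit_hardyInner_gsT hm ha' hinj,
    fun _ _ => CliffTM.hardyInner_gsT_of_ne hm ha' hinj,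
    fun _ _ => CliffTM.hardyInner_tmB_of_ne hm ha' hinj,
    CliffTM.hardyNorm_gsT_pos hm ha' hinj,
    fun n => ⟨CliffTM.hardyNorm_tmB hm ha' hinj n, by
      rw [CliffTM.Sc_hardyInner_self (hB n), CliffTM.hardyNorm_tmB hm ha' hinj n, one_pow]⟩⟩
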